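/- **Setting.** Let $E\subset\mathbb C$ be an infinite compact set such that $\overline{\mathbb C}\setminus E$ is simply connected, and let $\Phi$ be the conformal map of $\overline{\mathbb C}\setminus E$ onto $\{|w|>1\}\cup\{\infty\}$ with $\Phi(\infty)=\infty$ and $\Phi'(\infty)=\lim_{z\to\infty}\Phi(z)/z>0$. For $1<\rho\le\infty$ put $D_\rho=E\cup\{z\in\mathbb C\setminus E:|\Phi(z)|<\rho\}$ (so $D_\infty=\mathbb C$). Let $\mathcal H(E)$ be the set of functions holomorphic in some neighborhood of $E$. For $F\in\mathcal H(E)$ and an integer $k\ge 0$, let $\rho_k(F)\in(1,\infty]$ be the index of the largest $D_\rho$ to which $F$ extends meromorphically with at most $k$ poles, counting multiplicities (for $k=0$: to which $F$ extends holomorphically). Let $\mu$ be a finite positive Borel measure on $\mathbb C$ with infinite support contained in $E$, let $\langle g,h\rangle_\mu=\int g\,\overline h\,d\mu$, let $p_n(z)=\kappa_nz^n+\cdots$, $\kappa_n>0$, be its orthonormal polynomials, and let $s_n(z)=\int\frac{\overline{p_n(\zeta)}}{z-\zeta}\,d\mu(\zeta)$. For an integer $m\ge 1$ we write $\mu\in\mathbf{Reg}^m_{1,2}(E)$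 if $$\lim_{n\to\infty}|p_n(z)|^{1/n}=|\Phi(z)|,\qquad \lim_{n\to\infty}|s_n(z)|^{1/n}=|\Phi(z)|^{-1}$$ uniformly on compact subsets of $\mathbb C\setminus E$, and there are $c>0$ and $n_0$ with $\kappa_{n-m}/\kappa_n\ge c$ for all $n\ge n_0$, $n\geq m$. For $m\ge m^*\ge1$ and $n\ge1$, a *denominator of an $(n,m,m^*)$ incomplete orthogonal Padé approximant* of $F\in\mathcal H(E)$ with respect to $\mu$ is a monic polynomial $Q$ with $\deg Q\le m$ for which there are polynomials $P_0,\dots,P_{m^*-1}$ of degree at most $n-1$ such that $$\langle z^kQF-P_k,\;p_j\rangle_\mu=0,\qquad k=0,\dots,m^*-1,\quad j=0,\dots,n.$$ **Lemma.** Let $m\ge m^*\ge1$, $\mu\in\mathbf{Reg}^m_{1,2}(E)$ and $F\in\mathcal H(E)$, and suppose that $F$ is not a rational function with at most $m^*-1$ poles in $\mathbb C$, counting multiplicities. For each $n\ge1$ let $Q^\mu_{n,m,m^*}$ be a denominator of an $(n,m,m^*)$ incomplete orthogonal Padé approximant of $F$ with respect to $\mu$ (any choice), and suppose that there is a polynomial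 $Q_m$ of degree $m$ such that $$\limsup_{n\to\infty}\|Q^\mu_{n,m,m^*}-Q_m\|^{1/n}<1,$$ where $\|\cdot\|$ is the coefficient norm (the sum of the absolute values of the coefficients). Then $F$ (meromorphically extended) has exactly $m^*$ poles, counting multiplicities, in $D_{\rho_{m^*}(F)}$, or $\rho_0(Q_mF)>\rho_{m^*}(F)$ (or both). -/

import Mathlib

open Set Filter Topology MeasureTheory Polynomial
open scoped ENNReal ComplexConjugate

noncomputable section

namespace OrthPade

/-! ### Geometry of the compact set -/

/-- `E` is an infinite compact subset of the plane whose complement in the Riemann sphere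
is simply connected. -/
structure IsAdmissible (E : Set ℂ) : Prop where
  isCompact : IsCompact E
  infinite : E.Infinite
  simplyConnected : IsSimplyConnected (((↑) : ℂ → OnePoint ℂ) '' E)ᶜ

/-- `Φ` (restricted to `ℂ \ E`) is the exterior conformal map: it maps `ℂ \ E` conformally onto
`{|w| > 1}`, with `Φ(∞) = ∞` and `Φ'(∞) = lim Φ(z) / z > 0`. -/
structure IsExteriorMap (E : Set ℂ) (Φ : ℂ → ℂ) : Prop where
  holo : DifferentiableOn ℂ Φ Eᶜ
  bij : BijOn Φ Eᶜ {w | 1 < ‖w‖}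
  map_infty : Tendsto Φ (cocompact ℂ) (cocompact ℂ)
  deriv_infty : ∃ c : ℝ, 0 < c ∧ Tendsto (fun z => Φ z / z) (cocompact ℂ) (𝓝 (c : ℂ))

open Classical in
/-- The exterior conformal map of `E`; its values on `E` play no role. -/
def exteriorMap (E : Set ℂ) : ℂ → ℂ :=
  if h : ∃ Φ, IsExteriorMap E Φ then h.choose else 0

/-- The canonical domain `D_ρ = E ∪ {z ∉ E : |Φ(z)| < ρ}`, for `1 < ρ ≤ ∞`; `D_∞ = ℂ`. -/
def canonicalDomain (E : Set ℂ) (ρ : ℝ≥0∞) : Set ℂ :=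
  E ∪ {z | z ∉ E ∧ ENNReal.ofReal ‖exteriorMap E z‖ < ρ}

/-! ### Meromorphic continuation and poles -/

/-- `F ∈ H(E)`: `F` is holomorphic in some neighbourhood of `E`. -/
def HolomorphicNear (E : Set ℂ) (F : ℂ → ℂ) : Prop :=
  ∃ U : Set ℂ, IsOpen U ∧ E ⊆ U ∧ DifferentiableOn ℂ F U

/-- `G` is a meromorphic extension to `D` of the function given by `F` near `E`. -/
def IsMeromorphicExtension (E : Set ℂ) (F : ℂ → ℂ) (D : Set ℂ) (G : ℂ → ℂ) : Prop :=
  MeromorphicOn G D ∧ G =ᶠ[𝓝ˢ E] F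

/-- The order of `z` as a pole of `G` (`0` if `G` has no pole at `z`). -/
def poleOrder (G : ℂ → ℂ) (z : ℂ) : ℕ := (-(meromorphicOrderAt G z).untop₀).toNat

/-- The number of poles of `G` in `D`, counting multiplicities. -/
def poleCount (G : ℂ → ℂ) (D : Set ℂ) : ℕ∞ :=
  ⨆ (S : Finset ℂ) (_ : (S : Set ℂ) ⊆ D), ((∑ z ∈ S, poleOrder G z : ℕ) : ℕ∞)

/-- `ρ_k(F)`: the index of the largest canonical domain to which `F` extends as a meromorphic
function with at most `k` poles counting multiplicities. For `k = 0`, this is the index of the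
largest canonical domain to which `F` extends holomorphically. -/
def rhoIndex (E : Set ℂ) (k : ℕ) (F : ℂ → ℂ) : ℝ≥0∞ :=
  sSup {ρ | 1 < ρ ∧ ∃ G, IsMeromorphicExtension E F (canonicalDomain E ρ) G ∧
    poleCount G (canonicalDomain E ρ) ≤ k}

/-- Near `E`, the function `F` is a rational function with at most `k` poles (in `ℂ`, counting
multiplicities). -/
def IsRationalWithAtMostPoles (E : Set ℂ) (F : ℂ → ℂ) (k : ℕ) : Prop :=
  ∃ P q : ℂ[X], q ≠ 0 ∧ q.natDegree ≤ k ∧ ∀ᶠ z in 𝓝ˢ E, q.eval z * F z = P.eval z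

/-! ### Measures and orthonormal polynomials -/

/-- `μ ∈ M(E)`: a finite positive Borel measure with infinite support contained in `E`. -/
structure IsMeasureOn (E : Set ℂ) (μ : Measure ℂ) : Prop where
  finite : IsFiniteMeasure μ
  support_subset : μ.support ⊆ E
  support_infinite : μ.support.Infinite

/-- `⟨g, h⟩_μ = ∫ g conj(h) dμ`. -/
def ip (μ : Measure ℂ) (g h : ℂ → ℂ) : ℂ := ∫ z, g z * conj (h z) ∂μ

/-- `p n` is, for every `n`, the orthonormal polynomial of degree `n` of `μ` with positive
leading coefficient. -/
structure IsOrthonormalPolySeq (μ : Measure ℂ) (p : ℕ → ℂ[X]) : Prop where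
  natDegree_eq : ∀ n, (p n).natDegree = n
  leadingCoeff_pos : ∀ n, ∃ κ : ℝ, 0 < κ ∧ (p n).leadingCoeff = κ
  orthonormal : ∀ n k, ip μ (fun z => (p n).eval z) (fun z => (p k).eval z) =
    if n = k then 1 else 0

/-- Existence of the orthonormal polynomials (Gram-Schmidt), so that the choice below is never
vacuous for `μ ∈ M(E)`. -/
theorem exists_isOrthonormalPolySeq {E : Set ℂ} {μ : Measure ℂ} (hE : IsCompact E) (hμ : IsMeasureOn E μ) :
    ∃ p, IsOrthonormalPolySeq μ p := by
  have := hμ.finite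
  have hae : ∀ᵐ z ∂μ, z ∈ E :=
    by
    filter_upwards [Measure.support_mem_ae (μ := μ)] with z hz using hμ.support_subset hz
  have hint : ∀ f : ℂ → ℂ, Continuous f → Integrable f μ := fun f hf => by
    rw [← Measure.restrict_eq_self_of_ae_mem hae]
    exact hf.continuousOn.integrableOn_compact hE
  have hc : ∀ P Q : ℂ[X], Continuous fun z => conj (P.eval z) * Q.eval z := fun P Q =>
    (Complex.continuous_conj.comp P.continuous).mul Q.continuous
  let core : InnerProductSpace.Core ℂ ℂ[X] :=
    { inner := fun P Q => ∫ z, conj (P.eval z) * Q.eval z ∂μ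
      conj_inner_symm := fun P Q => by
        rw [← integral_conj]
        refine integral_congr_ae (Eventually.of_forall fun z => ?_)
        simp [mul_comm]
      re_inner_nonneg := fun P => by
        have : ∀ z, conj (P.eval z) * P.eval z = ((‖P.eval z‖ ^ 2 : ℝ) : ℂ) := fun z => by
          rw [mul_comm, Complex.mul_conj, Complex.normSq_eq_norm_sq]
        simp only [this]
        rw [show (∫ z, ((‖P.eval z‖ ^ 2 : ℝ) : ℂ) ∂μ) = ((∫ z, ‖P.eval z‖ ^ 2 ∂μ : ℝ) : ℂ) from
          integral_ofReal]
        simpa using integral_nonneg (μ := μ) fun z => by positivity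
      add_left := fun P Q R => by
        rw [← integral_add (hint _ (hc P R)) (hint _ (hc Q R))]
        simp [add_mul]
      smul_left := fun P Q r => by
        rw [← integral_const_mul]
        simp [mul_assoc]
      definite := fun P hP => by
        have e : ∀ z, conj (P.eval z) * P.eval z = ((‖P.eval z‖ ^ 2 : ℝ) : ℂ) := fun z => by
          rw [mul_comm, Complex.mul_conj, Complex.normSq_eq_norm_sq]
        simp only [e] at hP
        rw [show (∫ z, ((‖P.eval z‖ ^ 2 : ℝ) : ℂ) ∂μ) = ((∫ z, ‖P.eval z‖ ^ 2 ∂μ : ℝ) : ℂ) from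
          integral_ofReal] at hP
        have hP' : ∫ z, ‖P.eval z‖ ^ 2 ∂μ = 0 := by exact_mod_cast hP
        have hcn : Continuous fun z => ‖P.eval z‖ ^ 2 := by fun_prop
        have hi : Integrable (fun z => ‖P.eval z‖ ^ 2) μ := by
          rw [← Measure.restrict_eq_self_of_ae_mem hae]
          exact hcn.continuousOn.integrableOn_compact hE
        rw [integral_eq_zero_iff_of_nonneg (fun z => by positivity) hi] at hP'
        have hcl : IsClosed {z | P.eval z = 0} := isClosed_eq P.continuous continuous_const
        have hs : μ.support ⊆ {z | P.eval z = 0} :=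
          Measure.support_subset_of_isClosed hcl (hP'.mono fun z hz => by simpa using hz)
        exact Polynomial.eq_zero_of_infinite_isRoot P (hμ.support_infinite.mono hs) }
  let _ : NormedAddCommGroup ℂ[X] := core.toNormedAddCommGroup
  let _ : InnerProductSpace ℂ ℂ[X] := InnerProductSpace.ofCore core.toCore
  have hinner : ∀ P Q : ℂ[X], inner ℂ P Q = ∫ z, conj (P.eval z) * Q.eval z ∂μ := fun _ _ => rfl
  let f : ℕ → ℂ[X] := fun n => X ^ n
  have hf : LinearIndependent ℂ f := by
    have := (Polynomial.basisMonomials ℂ).linearIndependent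
    simpa [f, Polynomial.X_pow_eq_monomial, Polynomial.coe_basisMonomials] using this
  let g := InnerProductSpace.gramSchmidt ℂ f
  have hsub : ∀ n, (f n - g n) ∈ Polynomial.degreeLT ℂ n := by
    intro n
    have h1 : f n - g n ∈ Submodule.span ℂ (g '' Set.Iio n) := by
      have := InnerProductSpace.gramSchmidt_def' ℂ f n
      rw [this, add_sub_cancel_left]
      refine Submodule.sum_mem _ fun i hi => ?_
      have hle : (ℂ ∙ g i) ≤ Submodule.span ℂ (g '' Set.Iio n) :=
        Submodule.span_mono (by
          rintro _ rfl
          exact ⟨i, by simpa using hi, rfl⟩)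
      exact hle (Submodule.starProjection_apply_mem _ _)
    rw [InnerProductSpace.span_gramSchmidt_Iio] at h1
    refine (Submodule.span_le.2 ?_) h1
    rintro _ ⟨i, hi, rfl⟩
    rw [SetLike.mem_coe, Polynomial.mem_degreeLT]
    simp only [f, degree_X_pow]
    exact_mod_cast hi
  have hg : ∀ n, (g n).Monic ∧ (g n).natDegree = n := by
    intro n
    have h2 : (f n - g n).degree < (X ^ n : ℂ[X]).degree := by
      rw [degree_X_pow]; exact Polynomial.mem_degreeLT.1 (hsub n)
    have e : g n = X ^ n - (f n - g n) := by simp [f]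
    rw [e]
    refine ⟨(monic_X_pow n).sub_of_left h2, ?_⟩
    rw [natDegree_eq_of_degree_eq (degree_sub_eq_left_of_degree_lt h2), natDegree_X_pow]
  have hne : ∀ n, g n ≠ 0 := fun n => (hg n).1.ne_zero
  have hnorm : ∀ n, InnerProductSpace.gramSchmidtNormed ℂ f n = ((‖g n‖ : ℂ)⁻¹) • g n :=
    fun n => rfl
  refine ⟨InnerProductSpace.gramSchmidtNormed ℂ f, ⟨fun n => ?_, fun n => ?_, fun n k => ?_⟩⟩
  · rw [hnorm, natDegree_smul _ (by simpa using hne n), (hg n).2]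
  · refine ⟨‖g n‖⁻¹, inv_pos.2 (norm_pos_iff.2 (hne n)), ?_⟩
    rw [hnorm, leadingCoeff_smul_of_smul_regular _
      (IsSMulRegular.of_ne_zero (by simpa using hne n)), (hg n).1.leadingCoeff]
    simp
  · have := InnerProductSpace.gramSchmidtNormed_orthonormal (𝕜 := ℂ) hf
    have := (orthonormal_iff_ite.1 this) k n
    rw [hinner] at this
    rw [ip]
    simp only [mul_comm, eq_comm] at this ⊢
    exact this

open Classical in
/-- The orthonormal polynomials `p_n` of `μ`. -/
def orthoPoly (μ : Measure ℂ) : ℕ → ℂ[X] :=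
  if h : ∃ p, IsOrthonormalPolySeq μ p then h.choose else 0

theorem orthoPoly_spec {E : Set ℂ} {μ : Measure ℂ} (hE : IsCompact E) (hμ : IsMeasureOn E μ) :
    IsOrthonormalPolySeq μ (orthoPoly μ) := by
  have h := exists_isOrthonormalPolySeq hE hμ
  rw [orthoPoly, dif_pos h]
  exact h.choose_spec

/-- The leading coefficient `κ_n > 0` of `p_n`. -/
def kappa (μ : Measure ℂ) (n : ℕ) : ℝ := (orthoPoly μ n).leadingCoeff.re

/-- The second type function `s_n(z) = ∫ conj(p_n(ζ)) / (z - ζ) dμ(ζ)`. -/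
def secondType (μ : Measure ℂ) (n : ℕ) (z : ℂ) : ℂ :=
  ∫ ζ, conj ((orthoPoly μ n).eval ζ) / (z - ζ) ∂μ

/-- `μ ∈ Reg_{1,2}(E)`: `|p_n|^{1/n} → |Φ|` and `|s_n|^{1/n} → |Φ|⁻¹`, uniformly on compact
subsets of `ℂ \ E`. -/
structure IsReg12 (E : Set ℂ) (μ : Measure ℂ) : Prop where
  isMeasureOn : IsMeasureOn E μ
  reg1 : ∀ K : Set ℂ, IsCompact K → K ⊆ Eᶜ →
    TendstoUniformlyOn (fun (n : ℕ) z => ‖(orthoPoly μ n).eval z‖ ^ (1 / (n : ℝ)))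
      (fun z => ‖exteriorMap E z‖) atTop K
  reg2 : ∀ K : Set ℂ, IsCompact K → K ⊆ Eᶜ →
    TendstoUniformlyOn (fun (n : ℕ) z => ‖secondType μ n z‖ ^ (1 / (n : ℝ)))
      (fun z => ‖exteriorMap E z‖⁻¹) atTop K

/-- `μ ∈ Reg^m_{1,2}(E)`: in addition, `κ_{n-m} / κ_n` is bounded below by a positive constant
for all large `n`. -/
structure IsReg12m (E : Set ℂ) (m : ℕ) (μ : Measure ℂ) : Prop where
  isReg12 : IsReg12 E μ
  ratio : ∃ c : ℝ, 0 < c ∧ ∃ n₀ : ℕ, ∀ n, n₀ ≤ n → m ≤ n → c ≤ kappa μ (n - m) / kappa μ n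

/-! ### Incomplete orthogonal Padé approximants -/

/-- `Q` is a (monic) denominator of an `(n, m, m')` incomplete orthogonal Padé approximant of `F`
with respect to `μ`. -/
def IsIncompletePadeDenominator (μ : Measure ℂ) (F : ℂ → ℂ) (n m m' : ℕ) (Q : ℂ[X]) : Prop :=
  Q.Monic ∧ Q.natDegree ≤ m ∧
    ∃ P : ℕ → ℂ[X], ∀ k, k < m' → (P k).degree < n ∧
      ∀ j, j ≤ n →
        ip μ (fun z => Q.eval z * z ^ k * F z - (P k).eval z)
          (fun z => (orthoPoly μ j).eval z) = 0

/-- A coefficient norm on polynomials: the sum of the absolute values of the coefficients. -/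
def coeffNorm (P : ℂ[X]) : ℝ := ∑ i ∈ P.support, ‖P.coeff i‖

end OrthPade

end

/-!
The core is overconvergence: since `Q_n → Q_m` geometrically, multiplication by `Q_m` continues `T
F`, for every polynomial `T` of degree less than `m*`, beyond the largest canonical domain known
beforehand. The defining relations of `Q_n` say that `⟨Q_n T F, p_n⟩ = 0`, so that `⟨Q_m T F, p_n⟩
= ⟨(Q_m - Q_n) T F, p_n⟩` is smaller by a factor `θ ^ n`, `θ < 1`, than the coefficients of `T F`
(`exists_mul_mem_clearingIdeal`). Here the decay of Fourier coefficients measures the domain of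
holomorphy: by the Cauchy formula on the level curves `|Φ| = r` (`cauchy_formula`) the
coefficients are integrals of the second type functions `s_n` (`exists_norm_fourierCoef_le`), and
conversely the Fourier series converges, to the right function, as far as its coefficients permit
(`eqOn_fourierSeries`).

The Cauchy formula is obtained without contour topology: the Cauchy-type integrals over two level
curves differ by `H` between the curves (`cauchyType_jump`), so that the error of the formula is
the restriction of an entire function vanishing at infinity.

Poles are handled through the ideal of the polynomials `T` for which `T F` is holomorphic on `D_ρ`
(`clearingIdeal`). Let `R = ρ_{m*}(F)`, which is attained (`exists_mem_clearingIdeal_rhoIndex`),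
and let `T` generate the ideal for `D_R`; its degree is the number of poles of `F` in `D_R`. If
this number is less than `m*`, the overconvergence argument, applied at each pole, shows that `T`
divides `Q_m` (`pole_polynomial_dvd`). Applied to `T` itself it gives, for `R < ∞`, that `Q_m T F`
is holomorphic on a larger `D_ρ`; as the zeros of `T` lie in `D_R`, where `Q_m F` is already
holomorphic, so is `Q_m F` (`mem_clearingIdeal_of_mul_prod`). If `R = ∞`, then `T F` is entire,
and the lower bound for `κ_{n-m} / κ_n` turns the orthogonality relations into a recurrence for
its coefficients whose nonzero solutions cannot decay superexponentially; so `T F` is a polynomial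
(`exists_eq_polynomial_of_entire`) and `F` is rational with fewer than `m*` poles, which is
excluded.
-/

open Set Filter Topology MeasureTheory Polynomial
open scoped ENNReal ComplexConjugate

noncomputable section

namespace OrthPade

/-! ### The inverse of the exterior map -/

/-- The inverse `{|w| > 1} → ℂ \ E` of the exterior conformal map; its values on `{|w| ≤ 1}` play no
role. -/
def exteriorInv (E : Set ℂ) : ℂ → ℂ := Function.invFunOn (exteriorMap E) Eᶜ

section Geometry

variable {E : Set ℂ}

theorem isOpen_one_lt_norm : IsOpen {w : ℂ | 1 < ‖w‖} :=
  isOpen_lt continuous_const continuous_norm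

theorem IsExteriorMap.one_lt_norm {Φ : ℂ → ℂ} (h : IsExteriorMap E Φ) {z : ℂ} (hz : z ∉ E) :
    1 < ‖Φ z‖ := h.bij.mapsTo hz

theorem exteriorInv_notMem (h : IsExteriorMap E (exteriorMap E)) {w : ℂ} (hw : 1 < ‖w‖) :
    exteriorInv E w ∉ E :=
  Function.invFunOn_mem (h.bij.surjOn hw)

theorem exteriorMap_exteriorInv (h : IsExteriorMap E (exteriorMap E)) {w : ℂ} (hw : 1 < ‖w‖) :
    exteriorMap E (exteriorInv E w) = w :=
  Function.invFunOn_eq (h.bij.surjOn hw)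

theorem exteriorInv_exteriorMap (h : IsExteriorMap E (exteriorMap E)) {z : ℂ} (hz : z ∉ E) :
    exteriorInv E (exteriorMap E z) = z :=
  h.bij.injOn.leftInvOn_invFunOn hz

theorem analyticAt_exteriorMap (hE : IsCompact E) (h : IsExteriorMap E (exteriorMap E)) {z : ℂ}
    (hz : z ∉ E) : AnalyticAt ℂ (exteriorMap E) z :=
  h.holo.analyticAt (hE.isClosed.isOpen_compl.mem_nhds hz)

theorem not_eventually_exteriorMap_eq (hE : IsCompact E) (h : IsExteriorMap E (exteriorMap E))
    {z : ℂ} (hz : z ∉ E) : ¬ ∀ᶠ x in 𝓝 z, exteriorMap E x = exteriorMap E z := by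
  intro hc
  have hc2 : ∀ᶠ x in 𝓝[≠] z, x = z := by
    filter_upwards [hc.filter_mono nhdsWithin_le_nhds,
      mem_nhdsWithin_of_mem_nhds (hE.isClosed.isOpen_compl.mem_nhds hz)] with x hx hxE
    exact h.bij.injOn hxE hz hx
  obtain ⟨x, hx, hx'⟩ := (hc2.and self_mem_nhdsWithin).exists
  exact hx' hx

theorem continuousAt_exteriorInv (hE : IsCompact E) (h : IsExteriorMap E (exteriorMap E)) {w : ℂ}
    (hw : 1 < ‖w‖) : ContinuousAt (exteriorInv E) w := by
  set z := exteriorInv E w with hz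
  have hzE : z ∉ E := exteriorInv_notMem h hw
  have hle : 𝓝 (exteriorMap E z) ≤ map (exteriorMap E) (𝓝 z) :=
    ((analyticAt_exteriorMap hE h hzE).eventually_constant_or_nhds_le_map_nhds).resolve_left
      (not_eventually_exteriorMap_eq hE h hzE)
  rw [exteriorMap_exteriorInv h hw] at hle
  refine Tendsto.mono_left ?_ hle
  rw [tendsto_map'_iff]
  refine tendsto_id.congr' ?_
  filter_upwards [hE.isClosed.isOpen_compl.mem_nhds hzE] with x hx
  exact (exteriorInv_exteriorMap h hx).symm

/-- Where the derivative of the exterior map does not vanish this is the inverse function theorem;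
the zeros of the derivative are isolated, hence give removable singularities of the inverse. -/
theorem analyticAt_exteriorInv (hE : IsCompact E) (h : IsExteriorMap E (exteriorMap E)) {w : ℂ}
    (hw : 1 < ‖w‖) : AnalyticAt ℂ (exteriorInv E) w := by
  have hzE := exteriorInv_notMem h hw
  have hcont := continuousAt_exteriorInv hE h hw
  have key : ∀ v, 1 < ‖v‖ → deriv (exteriorMap E) (exteriorInv E v) ≠ 0 →
      DifferentiableAt ℂ (exteriorInv E) v := fun v hv hd =>
    (HasDerivAt.of_local_left_inverse (continuousAt_exteriorInv hE h hv)
      (analyticAt_exteriorMap hE h (exteriorInv_notMem h hv)).differentiableAt.hasDerivAt hd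
      (by filter_upwards [isOpen_one_lt_norm.mem_nhds hv] with u hu
          exact exteriorMap_exteriorInv h hu)).differentiableAt
  refine Complex.analyticAt_of_differentiable_on_punctured_nhds_of_continuousAt ?_ hcont
  have hne : ∀ᶠ x in 𝓝[≠] (exteriorInv E w), deriv (exteriorMap E) x ≠ 0 := by
    refine Or.resolve_left
      (analyticAt_exteriorMap hE h hzE).deriv.eventually_eq_zero_or_eventually_ne_zero
      fun h0 => not_eventually_exteriorMap_eq hE h hzE ?_
    have h1 := (hE.isClosed.isOpen_compl.mem_nhds hzE)
    obtain ⟨ε, hε, hb⟩ := Metric.mem_nhds_iff.1 (inter_mem h0 h1)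
    filter_upwards [Metric.ball_mem_nhds _ hε] with x hx
    refine (convex_ball (exteriorInv E w) ε).is_const_of_fderivWithin_eq_zero (𝕜 := ℂ)
      (f := exteriorMap E) ?_ ?_ hx (Metric.mem_ball_self hε)
    · exact h.holo.mono fun y hy => (hb hy).2
    · intro y hy
      rw [fderivWithin_of_isOpen Metric.isOpen_ball hy]
      ext
      simpa using (hb hy).1
  have ht : Tendsto (exteriorInv E) (𝓝[≠] w) (𝓝[≠] (exteriorInv E w)) := by
    refine tendsto_nhdsWithin_iff.2 ⟨hcont.mono_left nhdsWithin_le_nhds, ?_⟩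
    filter_upwards [self_mem_nhdsWithin,
      mem_nhdsWithin_of_mem_nhds (isOpen_one_lt_norm.mem_nhds hw)] with v hv hv1 he
    apply hv
    rw [mem_singleton_iff] at he ⊢
    rw [← exteriorMap_exteriorInv h hv1, he, exteriorMap_exteriorInv h hw]
  filter_upwards [ht.eventually hne,
    mem_nhdsWithin_of_mem_nhds (isOpen_one_lt_norm.mem_nhds hw)] with v hv hv1
  exact key v hv1 hv

theorem deriv_exteriorInv_ne_zero (hE : IsCompact E) (h : IsExteriorMap E (exteriorMap E)) {w : ℂ}
    (hw : 1 < ‖w‖) : deriv (exteriorInv E) w ≠ 0 := by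
  have h1 := (analyticAt_exteriorInv hE h hw).differentiableAt.hasDerivAt
  have h2 := (analyticAt_exteriorMap hE h (exteriorInv_notMem h hw)).differentiableAt.hasDerivAt
  have h3 := h2.comp w h1
  have h4 : HasDerivAt (exteriorMap E ∘ exteriorInv E) 1 w :=
    (hasDerivAt_id w).congr_of_eventuallyEq (by
      filter_upwards [isOpen_one_lt_norm.mem_nhds hw] with u hu
      exact exteriorMap_exteriorInv h hu)
  intro h0
  have := h3.unique h4
  simp [h0] at this

theorem exteriorInv_injOn (h : IsExteriorMap E (exteriorMap E)) :
    InjOn (exteriorInv E) {w | 1 < ‖w‖} := fun a ha b hb hab => by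
  rw [← exteriorMap_exteriorInv h ha, hab, exteriorMap_exteriorInv h hb]

/-! ### Canonical domains -/

/-- Annuli are connected, being images of strips under the exponential map. -/
theorem isPreconnected_norm_preimage {I : Set ℝ} (hI : I.OrdConnected) (hpos : I ⊆ Ioi 0) :
    IsPreconnected {w : ℂ | ‖w‖ ∈ I} := by
  have : {w : ℂ | ‖w‖ ∈ I} = Complex.exp '' (Complex.reCLM ⁻¹' (Real.exp ⁻¹' I)) := by
    ext w
    constructor
    · intro hw
      have hw0 : w ≠ 0 := norm_pos_iff.1 (hpos hw)
      refine ⟨Complex.log w, ?_, Complex.exp_log hw0⟩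
      simp only [mem_preimage, Complex.reCLM_apply, Complex.log_re]
      rwa [Real.exp_log (norm_pos_iff.2 hw0)]
    · rintro ⟨s, hs, rfl⟩
      simpa [Complex.norm_exp] using hs
  rw [this]
  refine IsPreconnected.image ?_ _ Complex.continuous_exp.continuousOn
  have h1 : (Real.exp ⁻¹' I).OrdConnected := hI.preimage_mono Real.exp_monotone
  exact (h1.convex.linear_preimage Complex.reCLM.toLinearMap).isPreconnected

theorem bounded_preimage (h : IsExteriorMap E (exteriorMap E)) (M : ℝ) :
    ∃ B : ℝ, ∀ z, ‖exteriorMap E z‖ ≤ M → ‖z‖ ≤ B := by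
  have h1 : ∀ᶠ z in cocompact ℂ, M < ‖exteriorMap E z‖ :=
    (tendsto_norm_cocompact_atTop.comp h.map_infty).eventually_gt_atTop M
  rw [← Metric.cobounded_eq_cocompact, Filter.eventually_iff, ← Bornology.isCobounded_def] at h1
  obtain ⟨B, hB⟩ := h1.compl.exists_norm_le
  exact ⟨B, fun z hz => hB z (by simpa using hz)⟩

/-- The exterior map takes a neighbourhood of infinity onto a neighbourhood of infinity; since it is
injective it is bounded on bounded sets. -/
theorem exists_norm_exteriorMap_le (hE : IsCompact E) (h : IsExteriorMap E (exteriorMap E))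
    (B : ℝ) :
    ∃ M : ℝ, ∀ z, z ∉ E → ‖z‖ ≤ B → ‖exteriorMap E z‖ ≤ M := by
  obtain ⟨B₀, hB₀⟩ := hE.isBounded.exists_norm_le
  set R : ℝ := max (max B B₀) 0 + 1
  have hRB : B < R := by have := le_max_left B B₀; have := le_max_left (max B B₀) 0; linarith
  have hRB₀ : B₀ < R := by have := le_max_right B B₀; have := le_max_left (max B B₀) 0; linarith
  have hout : ∀ z : ℂ, R ≤ ‖z‖ → z ∉ E := fun z hz hzE => by
    have := hB₀ z hzE; linarith
  have hcontOn : ContinuousOn (exteriorMap E) {z : ℂ | R ≤ ‖z‖} :=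
    h.holo.continuousOn.mono fun z hz => hout z hz
  obtain ⟨M₀, hM₀⟩ : ∃ M, ∀ z : ℂ, ‖z‖ = R → ‖exteriorMap E z‖ ≤ M := by
    obtain ⟨M, hM⟩ := (isCompact_sphere (0 : ℂ) R).exists_bound_of_continuousOn
      (hcontOn.mono fun z hz => (mem_sphere_zero_iff_norm.1 hz).ge)
    exact ⟨M, fun z hz => hM z (mem_sphere_zero_iff_norm.2 hz)⟩
  set M := max M₀ 1
  have hM0 : 0 < M := lt_of_lt_of_le one_pos (le_max_right _ _)
  refine ⟨M, fun z hzE hzB => ?_⟩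
  by_contra! hlt
  -- the image of `{|z| ≥ R}` is closed, that of `{|z| > R}` is open; they agree on `{|w| > M}`
  set C : Set ℂ := exteriorMap E '' {z | R ≤ ‖z‖}
  set O : Set ℂ := exteriorMap E '' {z | R < ‖z‖}
  have hC : IsClosed C := by
    refine isClosed_of_closure_subset fun w hw => ?_
    obtain ⟨u, hu, hlim⟩ := mem_closure_iff_seq_limit.1 hw
    choose x hx hxu using hu
    obtain ⟨K, hK⟩ := (Metric.isBounded_range_of_tendsto u hlim).exists_norm_le
    obtain ⟨B', hB'⟩ := bounded_preimage h K
    have hxb : ∀ n, x n ∈ Metric.closedBall (0 : ℂ) B' ∩ {z | R ≤ ‖z‖} := fun n => by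
      refine ⟨mem_closedBall_zero_iff.2 (hB' _ ?_), hx n⟩
      rw [hxu]; exact hK _ (mem_range_self n)
    have hcomp : IsCompact (Metric.closedBall (0 : ℂ) B' ∩ {z | R ≤ ‖z‖}) :=
      (isCompact_closedBall _ _).inter_right (isClosed_le continuous_const continuous_norm)
    obtain ⟨a, ha, φ, hφ, hφl⟩ := hcomp.tendsto_subseq hxb
    refine ⟨a, ha.2, tendsto_nhds_unique ?_ (hlim.comp hφ.tendsto_atTop)⟩
    have hca : ContinuousAt (exteriorMap E) a :=
      (analyticAt_exteriorMap hE h (hout a ha.2)).continuousAt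
    refine (hca.tendsto.comp hφl).congr fun n => ?_
    simp [hxu]
  have hO : IsOpen O := by
    rw [isOpen_iff_mem_nhds]
    rintro _ ⟨a, ha, rfl⟩
    have haE := hout a (le_of_lt ha)
    have hle := Or.resolve_left
      (analyticAt_exteriorMap hE h haE).eventually_constant_or_nhds_le_map_nhds
      (not_eventually_exteriorMap_eq hE h haE)
    exact hle (image_mem_map ((isOpen_lt continuous_const continuous_norm).mem_nhds ha))
  have hconn : IsPreconnected {w : ℂ | ‖w‖ ∈ Ioi M} :=
    isPreconnected_norm_preimage ordConnected_Ioi fun x hx => hM0.trans hx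
  have hsub : {w : ℂ | ‖w‖ ∈ Ioi M} ⊆ O ∪ Cᶜ := by
    intro w hw
    by_cases hwC : w ∈ C
    · obtain ⟨a, ha, rfl⟩ := hwC
      rcases eq_or_lt_of_le (show R ≤ ‖a‖ from ha) with he | hl
      · have := hM₀ a he.symm
        have h2 : M < ‖exteriorMap E a‖ := hw
        have := le_max_left M₀ 1
        linarith
      · exact Or.inl ⟨a, hl, rfl⟩
    · exact Or.inr hwC
  have hempty : ¬ ({w : ℂ | ‖w‖ ∈ Ioi M} ∩ (O ∩ Cᶜ)).Nonempty := by
    rintro ⟨_, _, ⟨a, ha, rfl⟩, hn⟩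
    exact hn ⟨a, le_of_lt (show R < ‖a‖ from ha), rfl⟩
  have hne1 : ({w : ℂ | ‖w‖ ∈ Ioi M} ∩ O).Nonempty := by
    have h1 : ∀ᶠ z in cocompact ℂ, M < ‖exteriorMap E z‖ :=
      (tendsto_norm_cocompact_atTop.comp h.map_infty).eventually_gt_atTop M
    have h2 : ∀ᶠ z : ℂ in cocompact ℂ, R < ‖z‖ :=
      tendsto_norm_cocompact_atTop.eventually_gt_atTop R
    obtain ⟨a, ha, ha'⟩ := (h1.and h2).exists
    exact ⟨_, ha, a, ha', rfl⟩
  have hne2 : ({w : ℂ | ‖w‖ ∈ Ioi M} ∩ Cᶜ).Nonempty := by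
    refine ⟨_, hlt, ?_⟩
    rintro ⟨a, ha, hae⟩
    have := h.bij.injOn (hout a ha) hzE hae
    have ha' : R ≤ ‖a‖ := ha
    rw [this] at ha'
    linarith
  exact hempty (hconn _ _ hO hC.isOpen_compl hsub hne1 hne2)

theorem isClosed_le_norm_exteriorMap (hE : IsCompact E) (h : IsExteriorMap E (exteriorMap E))
    {r : ℝ} (hr : 1 < r) : IsClosed {z | z ∉ E ∧ r ≤ ‖exteriorMap E z‖} := by
  refine isClosed_of_closure_subset fun z hz => ?_
  obtain ⟨u, hu, hlim⟩ := mem_closure_iff_seq_limit.1 hz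
  obtain ⟨K, hK⟩ := (Metric.isBounded_range_of_tendsto u hlim).exists_norm_le
  obtain ⟨M, hM⟩ := exists_norm_exteriorMap_le hE h K
  have hcomp : IsCompact (Metric.closedBall (0 : ℂ) M ∩ {w | r ≤ ‖w‖}) :=
    (isCompact_closedBall _ _).inter_right (isClosed_le continuous_const continuous_norm)
  obtain ⟨a, ha, φ, hφ, hφl⟩ := hcomp.tendsto_subseq (x := fun n => exteriorMap E (u n)) fun n =>
    ⟨mem_closedBall_zero_iff.2 (hM _ (hu n).1 (hK _ (mem_range_self n))), (hu n).2⟩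
  have ha1 : 1 < ‖a‖ := hr.trans_le ha.2
  have hza : z = exteriorInv E a := by
    refine tendsto_nhds_unique (hlim.comp hφ.tendsto_atTop) ?_
    refine ((continuousAt_exteriorInv hE h ha1).tendsto.comp hφl).congr fun n => ?_
    exact exteriorInv_exteriorMap h (hu (φ n)).1
  rw [hza]
  refine ⟨exteriorInv_notMem h ha1, ?_⟩
  rw [exteriorMap_exteriorInv h ha1]
  exact ha.2

theorem subset_canonicalDomain {ρ : ℝ≥0∞} : E ⊆ canonicalDomain E ρ := fun _ hz => Or.inl hz

theorem canonicalDomain_mono {ρ ρ' : ℝ≥0∞} (hle : ρ ≤ ρ') :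
    canonicalDomain E ρ ⊆ canonicalDomain E ρ' :=
  union_subset_union_right _ fun _ hz => ⟨hz.1, hz.2.trans_le hle⟩

theorem mem_canonicalDomain_iff {ρ : ℝ≥0∞} {z : ℂ} (hz : z ∉ E) :
    z ∈ canonicalDomain E ρ ↔ ENNReal.ofReal ‖exteriorMap E z‖ < ρ := by
  simp [canonicalDomain, hz]

theorem mem_canonicalDomain_ofReal {r : ℝ} {z : ℂ} (hz : z ∉ E) :
    z ∈ canonicalDomain E (ENNReal.ofReal r) ↔ ‖exteriorMap E z‖ < r := by
  rw [mem_canonicalDomain_iff hz, ENNReal.ofReal_lt_ofReal_iff']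
  exact ⟨fun h => h.1, fun h => ⟨h, (norm_nonneg _).trans_lt h⟩⟩

theorem one_lt_ofReal {r : ℝ} : 1 < ENNReal.ofReal r ↔ 1 < r := by
  rw [← ENNReal.ofReal_one, ENNReal.ofReal_lt_ofReal_iff']
  exact ⟨fun h => h.1, fun h => ⟨h, one_pos.trans h⟩⟩

theorem exists_mem_canonicalDomain_ofReal (h : IsExteriorMap E (exteriorMap E)) {ρ : ℝ≥0∞}
    (hρ : 1 < ρ) {z : ℂ} (hz : z ∈ canonicalDomain E ρ) :
    ∃ r : ℝ, 1 < r ∧ ENNReal.ofReal r < ρ ∧ z ∈ canonicalDomain E (ENNReal.ofReal r) := by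
  by_cases hzE : z ∈ E
  · obtain ⟨q, hq, hqρ⟩ := ENNReal.lt_iff_exists_real_btwn.1 hρ
    exact ⟨q, one_lt_ofReal.1 hqρ.1, hqρ.2, Or.inl hzE⟩
  · rw [mem_canonicalDomain_iff hzE] at hz
    obtain ⟨q, hq, hqρ⟩ := ENNReal.lt_iff_exists_real_btwn.1 hz
    have : ‖exteriorMap E z‖ < q := (ENNReal.ofReal_lt_ofReal_iff'.1 hqρ.1).1
    exact ⟨q, (h.one_lt_norm hzE).trans this, hqρ.2, (mem_canonicalDomain_ofReal hzE).2 this⟩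

theorem isOpen_canonicalDomain (hE : IsCompact E) (h : IsExteriorMap E (exteriorMap E))
    {ρ : ℝ≥0∞} (hρ : 1 < ρ) : IsOpen (canonicalDomain E ρ) := by
  have key : ∀ r : ℝ, 1 < r → IsOpen (canonicalDomain E (ENNReal.ofReal r)) := fun r hr => by
    have : canonicalDomain E (ENNReal.ofReal r) = {z | z ∉ E ∧ r ≤ ‖exteriorMap E z‖}ᶜ := by
      ext z
      by_cases hz : z ∈ E
      · simp [hz, subset_canonicalDomain hz]
      · simp [mem_canonicalDomain_ofReal hz, hz]
    rw [this]
    exact (isClosed_le_norm_exteriorMap hE h hr).isOpen_compl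
  rw [isOpen_iff_mem_nhds]
  intro z hz
  obtain ⟨r, hr, hrρ, hzr⟩ := exists_mem_canonicalDomain_ofReal h hρ hz
  exact mem_of_superset ((key r hr).mem_nhds hzr) (canonicalDomain_mono hrρ.le)

theorem isOpen_lt_norm_exteriorMap (hE : IsCompact E) (h : IsExteriorMap E (exteriorMap E))
    (r : ℝ) : IsOpen {z | z ∉ E ∧ r < ‖exteriorMap E z‖} :=
  h.holo.continuousOn.norm.isOpen_inter_preimage hE.isClosed.isOpen_compl isOpen_Ioi

theorem isBounded_norm_exteriorMap_le (hE : IsCompact E) (h : IsExteriorMap E (exteriorMap E))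
    (r : ℝ) : Bornology.IsBounded (E ∪ {z | z ∉ E ∧ ‖exteriorMap E z‖ ≤ r}) := by
  obtain ⟨B, hB⟩ := bounded_preimage h r
  refine hE.isBounded.union ((Metric.isBounded_closedBall (x := (0 : ℂ)) (r := B)).subset ?_)
  exact fun z hz => mem_closedBall_zero_iff.2 (hB z hz.2)

theorem isCompact_norm_exteriorMap_le (hE : IsCompact E) (h : IsExteriorMap E (exteriorMap E))
    (r : ℝ) : IsCompact (E ∪ {z | z ∉ E ∧ ‖exteriorMap E z‖ ≤ r}) := by
  refine Metric.isCompact_of_isClosed_isBounded ?_ (isBounded_norm_exteriorMap_le hE h r)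
  have : E ∪ {z | z ∉ E ∧ ‖exteriorMap E z‖ ≤ r} = {z | z ∉ E ∧ r < ‖exteriorMap E z‖}ᶜ := by
    ext z
    by_cases hz : z ∈ E <;> simp [hz]
  rw [this]
  exact (isOpen_lt_norm_exteriorMap hE h r).isClosed_compl

theorem exists_canonicalDomain_subset (hE : IsCompact E) (h : IsExteriorMap E (exteriorMap E))
    {U : Set ℂ} (hU : IsOpen U) (hEU : E ⊆ U) :
    ∃ r : ℝ, 1 < r ∧ canonicalDomain E (ENNReal.ofReal r) ⊆ U := by
  set K := (E ∪ {z | z ∉ E ∧ ‖exteriorMap E z‖ ≤ 2}) \ U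
  have hK : IsCompact K := (isCompact_norm_exteriorMap_le hE h 2).diff hU
  have hKE : K ⊆ Eᶜ := fun z hz hzE => hz.2 (hEU hzE)
  rcases K.eq_empty_or_nonempty with he | hne
  · refine ⟨2, one_lt_two, fun z hz => ?_⟩
    by_contra hzU
    have : z ∈ K := ⟨?_, hzU⟩
    · rw [he] at this; exact this
    · by_cases hzE : z ∈ E
      · exact Or.inl hzE
      · exact Or.inr ⟨hzE, ((mem_canonicalDomain_ofReal hzE).1 hz).le⟩
  · obtain ⟨a, ha, hmin⟩ := hK.exists_isMinOn hne (h.holo.continuousOn.norm.mono hKE)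
    refine ⟨min 2 ‖exteriorMap E a‖, lt_min one_lt_two (h.one_lt_norm (hKE ha)), fun z hz => ?_⟩
    by_contra hzU
    have hzE : z ∉ E := fun h' => hzU (hEU h')
    rw [mem_canonicalDomain_ofReal hzE, lt_min_iff] at hz
    have hm : ‖exteriorMap E a‖ ≤ ‖exteriorMap E z‖ := hmin ⟨Or.inr ⟨hzE, hz.1.le⟩, hzU⟩
    linarith [hz.2]

/-- A part of `D_ρ` separated from the annular region `D_ρ \ E` would be open, compact and
contained in `E`. -/
theorem isPreconnected_canonicalDomain (hE : IsCompact E) (h : IsExteriorMap E (exteriorMap E))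
    {ρ : ℝ≥0∞} (hρ : 1 < ρ) : IsPreconnected (canonicalDomain E ρ) := by
  set D := canonicalDomain E ρ
  have hD : IsOpen D := isOpen_canonicalDomain hE h hρ
  set I : Set ℝ := {x | 1 < x ∧ ENNReal.ofReal x < ρ}
  have hI : I.OrdConnected := ⟨fun x hx y hy z hz =>
    ⟨hx.1.trans_le hz.1, (ENNReal.ofReal_le_ofReal hz.2).trans_lt hy.2⟩⟩
  have hA : IsPreconnected (D \ E) := by
    have he : D \ E = exteriorInv E '' {w | ‖w‖ ∈ I} := by
      ext z
      constructor
      · rintro ⟨hz, hzE⟩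
        exact ⟨exteriorMap E z, ⟨h.one_lt_norm hzE, (mem_canonicalDomain_iff hzE).1 hz⟩,
          exteriorInv_exteriorMap h hzE⟩
      · rintro ⟨w, hw, rfl⟩
        have := exteriorInv_notMem h hw.1
        refine ⟨(mem_canonicalDomain_iff this).2 ?_, this⟩
        rw [exteriorMap_exteriorInv h hw.1]; exact hw.2
    rw [he]
    refine (isPreconnected_norm_preimage hI fun x hx => one_pos.trans hx.1).image _ fun w hw => ?_
    exact (continuousAt_exteriorInv hE h hw.1).continuousWithinAt
  -- if `D \ E ⊆ u`, then `D ∩ v` is clopen in the plane and contained in `E`, hence empty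
  have aux : ∀ u v : Set ℂ, IsOpen u → IsOpen v → D ⊆ u ∪ v → D ∩ (u ∩ v) = ∅ → D \ E ⊆ u →
      D ⊆ u := by
    intro u v hu hv hcov hdis hAu
    have hVE : D ∩ v ⊆ E := fun z hz => by
      by_contra hzE
      have : z ∈ D ∩ (u ∩ v) := ⟨hz.1, hAu ⟨hz.1, hzE⟩, hz.2⟩
      rw [hdis] at this; exact this
    have hVcl : IsClosed (D ∩ v) := by
      refine isClosed_of_closure_subset fun z hz => ?_
      have hzE : z ∈ E := closure_minimal hVE hE.isClosed hz
      have hzD : z ∈ D := Or.inl hzE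
      refine ⟨hzD, (hcov hzD).resolve_left fun hzu => ?_⟩
      obtain ⟨y, hy1, hy2⟩ := mem_closure_iff.1 hz (D ∩ u) (hD.inter hu) ⟨hzD, hzu⟩
      have : y ∈ D ∩ (u ∩ v) := ⟨hy1.1, hy1.2, hy2.2⟩
      rw [hdis] at this; exact this
    rcases isClopen_iff.1 ⟨hVcl, hD.inter hv⟩ with h0 | h1
    · intro z hz
      refine (hcov hz).resolve_right fun hzv => ?_
      have : z ∈ D ∩ v := ⟨hz, hzv⟩
      rw [h0] at this; exact this
    · rw [h1] at hVE
      exact absurd (hE.of_isClosed_subset isClosed_univ hVE) (noncompact_univ ℂ)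
  rw [isPreconnected_iff_subset_of_disjoint]
  intro u v hu hv hcov hdis
  rcases (isPreconnected_iff_subset_of_disjoint.1 hA) u v hu hv (sdiff_subset.trans hcov)
    (subset_eq_empty (inter_subset_inter_left _ sdiff_subset) hdis) with h1 | h1
  · exact Or.inl (aux u v hu hv hcov hdis h1)
  · exact Or.inr (aux v u hv hu (by rwa [union_comm]) (by rwa [inter_comm v u]) h1)

theorem norm_exteriorMap_eq_of_mem_frontier (hE : IsCompact E)
    (h : IsExteriorMap E (exteriorMap E)) {r : ℝ} (hr : 1 < r) {z : ℂ}
    (hz : z ∈ frontier (canonicalDomain E (ENNReal.ofReal r))) :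
    z ∉ E ∧ ‖exteriorMap E z‖ = r := by
  have hD := isOpen_canonicalDomain hE h (one_lt_ofReal.2 hr)
  rw [hD.frontier_eq] at hz
  have hzE : z ∉ E := fun h' => hz.2 (Or.inl h')
  refine ⟨hzE, le_antisymm ?_ (not_lt.1 fun h' => hz.2 ((mem_canonicalDomain_ofReal hzE).2 h'))⟩
  have hsub : canonicalDomain E (ENNReal.ofReal r) ⊆ E ∪ {z | z ∉ E ∧ ‖exteriorMap E z‖ ≤ r} := by
    intro y hy
    by_cases hyE : y ∈ E
    · exact Or.inl hyE
    · exact Or.inr ⟨hyE, ((mem_canonicalDomain_ofReal hyE).1 hy).le⟩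
  rcases closure_minimal hsub (isCompact_norm_exteriorMap_le hE h r).isClosed hz.1 with h1 | h1
  · exact absurd h1 hzE
  · exact h1.2

theorem isCompact_level (hE : IsCompact E) (h : IsExteriorMap E (exteriorMap E)) {r : ℝ}
    (hr : 1 < r) : IsCompact {z | z ∉ E ∧ ‖exteriorMap E z‖ = r} := by
  have he : {z | z ∉ E ∧ ‖exteriorMap E z‖ = r} = exteriorInv E '' Metric.sphere 0 r := by
    ext z
    constructor
    · rintro ⟨hzE, hz⟩
      exact ⟨_, mem_sphere_zero_iff_norm.2 hz, exteriorInv_exteriorMap h hzE⟩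
    · rintro ⟨w, hw, rfl⟩
      rw [mem_sphere_zero_iff_norm] at hw
      have hw1 : 1 < ‖w‖ := hw ▸ hr
      exact ⟨exteriorInv_notMem h hw1, by rw [exteriorMap_exteriorInv h hw1, hw]⟩
  rw [he]
  refine (isCompact_sphere _ _).image_of_continuousOn fun w hw => ?_
  rw [mem_sphere_zero_iff_norm] at hw
  exact (continuousAt_exteriorInv hE h (hw ▸ hr)).continuousWithinAt

/-- Maximum principle on `D_r`. -/
theorem norm_le_of_norm_le_on_level (hE : IsCompact E) (h : IsExteriorMap E (exteriorMap E))
    {r : ℝ} (hr : 1 < r) {f : ℂ → ℂ} (hf : Differentiable ℂ f) {C : ℝ}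
    (hC : ∀ z, z ∉ E → ‖exteriorMap E z‖ = r → ‖f z‖ ≤ C) {z : ℂ}
    (hz : z ∈ canonicalDomain E (ENNReal.ofReal r)) : ‖f z‖ ≤ C := by
  refine Complex.norm_le_of_forall_mem_frontier_norm_le
    (U := canonicalDomain E (ENNReal.ofReal r)) ?_ hf.diffContOnCl (fun y hy => ?_)
    (subset_closure hz)
  · refine (isBounded_norm_exteriorMap_le hE h r).subset fun y hy => ?_
    by_cases hyE : y ∈ E
    · exact Or.inl hyE
    · exact Or.inr ⟨hyE, ((mem_canonicalDomain_ofReal hyE).1 hy).le⟩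
  · obtain ⟨h1, h2⟩ := norm_exteriorMap_eq_of_mem_frontier hE h hr hy
    exact hC y h1 h2

/-- The identity theorem on `D_ρ`. -/
theorem eqOn_canonicalDomain (hE : IsCompact E) (h : IsExteriorMap E (exteriorMap E))
    {ρ : ℝ≥0∞} (hρ : 1 < ρ) {f g : ℂ → ℂ} (hf : DifferentiableOn ℂ f (canonicalDomain E ρ))
    (hg : DifferentiableOn ℂ g (canonicalDomain E ρ)) {a : ℂ} (ha : a ∈ canonicalDomain E ρ)
    (hfg : ∃ᶠ z in 𝓝[≠] a, f z = g z) : EqOn f g (canonicalDomain E ρ) :=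
  (hf.analyticOnNhd (isOpen_canonicalDomain hE h hρ)).eqOn_of_preconnected_of_frequently_eq
    (hg.analyticOnNhd (isOpen_canonicalDomain hE h hρ)) (isPreconnected_canonicalDomain hE h hρ)
    ha hfg

end Geometry

/-! ### Cauchy-type integrals -/

section CauchyType

variable {X : Type*} [MeasurableSpace X] {ν : Measure X} {u φ : X → ℂ} {K : Set ℂ}

theorem differentiableAt_cauchyType (hK : IsCompact K) (hu : AEStronglyMeasurable u ν)
    (huK : ∀ᵐ x ∂ν, u x ∈ K) (hφ : Integrable φ ν) {z : ℂ} (hz : z ∉ K) :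
    DifferentiableAt ℂ (fun y => ∫ x, φ x / (u x - y) ∂ν) z := by
  obtain ⟨δ, hδ, hb⟩ := Metric.isOpen_iff.1 hK.isClosed.isOpen_compl z hz
  have hlow : ∀ a ∈ K, ∀ y ∈ Metric.ball z (δ / 2), δ / 2 ≤ ‖a - y‖ := by
    intro a ha y hy
    have h1 : δ ≤ dist a z := by
      by_contra! hlt
      exact hb hlt ha
    have h2 : dist y z < δ / 2 := hy
    have h3 := dist_triangle a y z
    rw [← dist_eq_norm]
    linarith
  have hmeas : ∀ y, AEStronglyMeasurable (fun x => φ x / (u x - y)) ν := fun y =>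
    (hφ.aemeasurable.div (hu.sub aestronglyMeasurable_const).aemeasurable).aestronglyMeasurable
  refine (hasDerivAt_integral_of_dominated_loc_of_deriv_le (𝕜 := ℂ) (μ := ν)
    (F := fun y x => φ x / (u x - y)) (F' := fun y x => φ x / (u x - y) ^ 2)
    (bound := fun x => ‖φ x‖ / (δ / 2) ^ 2) (Metric.ball_mem_nhds z (half_pos hδ))
    (Eventually.of_forall hmeas) ?_ ?_ ?_ (hφ.norm.div_const _) ?_).2.differentiableAt
  · refine Integrable.mono' (hφ.norm.div_const (δ / 2)) (hmeas z) ?_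
    filter_upwards [huK] with x hx
    rw [norm_div]
    gcongr
    exact hlow _ hx z (Metric.mem_ball_self (half_pos hδ))
  · exact (hφ.aemeasurable.div
      ((hu.sub aestronglyMeasurable_const).pow 2).aemeasurable).aestronglyMeasurable
  · filter_upwards [huK] with x hx y hy
    rw [norm_div, norm_pow]
    gcongr
    exact hlow _ hx y hy
  · filter_upwards [huK] with x hx y hy
    have hne : u x - y ≠ 0 := norm_pos_iff.1 ((half_pos hδ).trans_le (hlow _ hx y hy))
    have h1 : HasDerivAt (fun y => u x - y) (-1) y := (hasDerivAt_id y).const_sub (u x)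
    have h2 := (hasDerivAt_const y (φ x)).fun_div h1 hne
    rwa [show (0 * (u x - y) - φ x * -1) / (u x - y) ^ 2 = φ x / (u x - y) ^ 2 by ring] at h2

theorem norm_cauchyType_le {B : ℝ} (huB : ∀ᵐ x ∂ν, ‖u x‖ ≤ B) (hφ : Integrable φ ν) {z : ℂ}
    (hz : B < ‖z‖) : ‖∫ x, φ x / (u x - z) ∂ν‖ ≤ (∫ x, ‖φ x‖ ∂ν) / (‖z‖ - B) := by
  rw [← integral_div]
  refine norm_integral_le_of_norm_le (hφ.norm.div_const _) ?_
  filter_upwards [huB] with x hx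
  rw [norm_div]
  have := norm_sub_norm_le z (u x)
  rw [norm_sub_rev] at this
  have h0 : 0 < ‖z‖ - B := sub_pos.2 hz
  gcongr
  linarith

theorem tendsto_cauchyType {B : ℝ} (huB : ∀ᵐ x ∂ν, ‖u x‖ ≤ B) (hφ : Integrable φ ν) :
    Tendsto (fun z => ∫ x, φ x / (u x - z) ∂ν) (cocompact ℂ) (𝓝 0) := by
  refine squeeze_zero_norm' (a := fun z : ℂ => (∫ x, ‖φ x‖ ∂ν) / (‖z‖ - B)) ?_ ?_
  · filter_upwards [tendsto_norm_cocompact_atTop.eventually_gt_atTop B] with z hz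
    exact norm_cauchyType_le huB hφ hz
  · refine Tendsto.div_atTop tendsto_const_nhds ?_
    exact tendsto_atTop_add_const_right _ (-B) tendsto_norm_cocompact_atTop

end CauchyType

/-! ### The Cauchy formula on level curves -/

section CauchyFormula

variable {E : Set ℂ}

/-- The density `H(Ψ(w)) Ψ'(w)` that the substitution `ζ = Ψ(w)` makes of `H(ζ) dζ`, where `Ψ` is
the inverse of the exterior map. -/
def pullback (E : Set ℂ) (H : ℂ → ℂ) (w : ℂ) : ℂ := H (exteriorInv E w) * deriv (exteriorInv E) w

/-- The parametrised form of `H(ζ) dζ` on the level curve `|Φ| = r`. -/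
def levelDensity (E : Set ℂ) (H : ℂ → ℂ) (r θ : ℝ) : ℂ :=
  deriv (circleMap 0 r) θ * pullback E H (circleMap 0 r θ)

/-- The level curve `|Φ| = r`, parametrised by the argument of `Φ`. -/
def levelCurve (E : Set ℂ) (r θ : ℝ) : ℂ := exteriorInv E (circleMap 0 r θ)

theorem norm_circleMap_of_one_lt {r : ℝ} (hr : 1 < r) (θ : ℝ) : ‖circleMap 0 r θ‖ = r := by
  rw [norm_circleMap_zero, abs_of_pos (one_pos.trans hr)]

theorem levelCurve_spec (h : IsExteriorMap E (exteriorMap E)) {r : ℝ} (hr : 1 < r) (θ : ℝ) :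
    levelCurve E r θ ∉ E ∧ ‖exteriorMap E (levelCurve E r θ)‖ = r := by
  have h1 : 1 < ‖circleMap 0 r θ‖ := by rwa [norm_circleMap_of_one_lt hr]
  exact ⟨exteriorInv_notMem h h1, by
    rw [levelCurve, exteriorMap_exteriorInv h h1, norm_circleMap_of_one_lt hr]⟩

theorem continuous_levelCurve (hE : IsCompact E) (h : IsExteriorMap E (exteriorMap E)) {r : ℝ}
    (hr : 1 < r) : Continuous (levelCurve E r) := by
  refine continuous_iff_continuousAt.2 fun θ => ?_
  have h1 : 1 < ‖circleMap 0 r θ‖ := by rwa [norm_circleMap_of_one_lt hr]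
  exact (continuousAt_exteriorInv hE h h1).comp (continuous_circleMap 0 r).continuousAt

theorem exteriorInv_mem_canonicalDomain (h : IsExteriorMap E (exteriorMap E)) {ρ : ℝ≥0∞} {w : ℂ}
    (hw : 1 < ‖w‖) (hwρ : ENNReal.ofReal ‖w‖ < ρ) : exteriorInv E w ∈ canonicalDomain E ρ := by
  rw [mem_canonicalDomain_iff (exteriorInv_notMem h hw), exteriorMap_exteriorInv h hw]
  exact hwρ

theorem analyticAt_pullback (hE : IsCompact E) (h : IsExteriorMap E (exteriorMap E)) {ρ : ℝ≥0∞}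
    (hρ : 1 < ρ) {H : ℂ → ℂ} (hH : DifferentiableOn ℂ H (canonicalDomain E ρ)) {w : ℂ}
    (hw : 1 < ‖w‖) (hwρ : ENNReal.ofReal ‖w‖ < ρ) : AnalyticAt ℂ (pullback E H) w := by
  have h1 : AnalyticAt ℂ H (exteriorInv E w) :=
    hH.analyticAt ((isOpen_canonicalDomain hE h hρ).mem_nhds (exteriorInv_mem_canonicalDomain h
        hw hwρ))
  have h2 := analyticAt_exteriorInv hE h hw
  exact (h1.comp h2).mul h2.deriv

theorem continuous_levelDensity (hE : IsCompact E) (h : IsExteriorMap E (exteriorMap E))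
    {ρ : ℝ≥0∞} (hρ : 1 < ρ) {H : ℂ → ℂ} (hH : DifferentiableOn ℂ H (canonicalDomain E ρ)) {r : ℝ}
    (hr : 1 < r) (hrρ : ENNReal.ofReal r < ρ) : Continuous (levelDensity E H r) := by
  refine Continuous.mul ?_ ?_
  · have h1 : deriv (circleMap 0 r) = fun θ => circleMap 0 r θ * Complex.I :=
      funext fun θ => by simp [deriv_circleMap]
    rw [h1]
    exact (continuous_circleMap 0 r).mul continuous_const
  · refine continuous_iff_continuousAt.2 fun θ => ?_
    have h1 : 1 < ‖circleMap 0 r θ‖ := by rwa [norm_circleMap_of_one_lt hr]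
    exact ContinuousAt.comp (analyticAt_pullback hE h hρ hH h1
      (by rwa [norm_circleMap_of_one_lt hr])).continuousAt (continuous_circleMap 0 r).continuousAt

theorem integrable_levelDensity (hE : IsCompact E) (h : IsExteriorMap E (exteriorMap E))
    {ρ : ℝ≥0∞} (hρ : 1 < ρ) {H : ℂ → ℂ} (hH : DifferentiableOn ℂ H (canonicalDomain E ρ)) {r : ℝ}
    (hr : 1 < r) (hrρ : ENNReal.ofReal r < ρ) :
    IntegrableOn (levelDensity E H r) (Ioc 0 (2 * Real.pi)) :=
  ((continuous_levelDensity hE h hρ hH hr hrρ).integrableOn_Icc).mono_set Ioc_subset_Icc_self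

theorem circleIntegral_pullback (H : ℂ → ℂ) (r : ℝ) (f : ℂ → ℂ) :
    (∮ w in C(0, r), pullback E H w * f (exteriorInv E w)) =
      ∫ θ in Ioc 0 (2 * Real.pi), levelDensity E H r θ * f (levelCurve E r θ) := by
  rw [circleIntegral, intervalIntegral.integral_of_le Real.two_pi_pos.le]
  simp only [levelDensity, levelCurve, smul_eq_mul, mul_assoc]

/-- The jump of the Cauchy-type integral of `H` between two level curves: with `w₀ = Φ(z)`, the
integrand `H(Ψ(w)) Ψ'(w) / (Ψ(w) - z)` has in the annulus `r₀ ≤ |w| ≤ r₁` only a simple pole at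
`w₀`, with residue `H(z)`. -/
theorem cauchyType_jump (hE : IsCompact E) (h : IsExteriorMap E (exteriorMap E))
    {ρ : ℝ≥0∞} (hρ : 1 < ρ) {H : ℂ → ℂ} (hH : DifferentiableOn ℂ H
        (canonicalDomain E ρ)) {r₀ r₁ : ℝ}
    (hr₀ : 1 < r₀) (hr₁ρ : ENNReal.ofReal r₁ < ρ) {z : ℂ} (hzE : z ∉ E)
    (hz₀ : r₀ < ‖exteriorMap E z‖) (hz₁ : ‖exteriorMap E z‖ < r₁) :
    (∮ w in C(0, r₁), pullback E H w * (exteriorInv E w - z)⁻¹) -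
      (∮ w in C(0, r₀), pullback E H w * (exteriorInv E w - z)⁻¹) =
          2 * Real.pi * Complex.I * H z := by
  set w₀ := exteriorMap E z with hw₀
  have hw₀1 : 1 < ‖w₀‖ := hr₀.trans hz₀
  have hψw₀ : exteriorInv E w₀ = z := exteriorInv_exteriorMap h hzE
  set A : Set ℂ := {w | 1 < ‖w‖ ∧ ENNReal.ofReal ‖w‖ < ρ}
  have hw₀A : w₀ ∈ A := ⟨hw₀1, (ENNReal.ofReal_le_ofReal hz₁.le).trans_lt hr₁ρ⟩
  have hAo : IsOpen A := (isOpen_lt continuous_const continuous_norm).inter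
    (isOpen_lt (ENNReal.continuous_ofReal.comp continuous_norm) continuous_const)
  have hψA : DifferentiableOn ℂ (exteriorInv E) A := fun w hw =>
    (analyticAt_exteriorInv hE h hw.1).differentiableAt.differentiableWithinAt
  have hgA : DifferentiableOn ℂ (pullback E H) A := fun w hw =>
    (analyticAt_pullback hE h hρ hH hw.1 hw.2).differentiableAt.differentiableWithinAt
  set σ := dslope (exteriorInv E) w₀
  have hσA : DifferentiableOn ℂ σ A :=
    (Complex.differentiableOn_dslope (hAo.mem_nhds hw₀A)).2 hψA
  have hσne : ∀ w ∈ A, σ w ≠ 0 := by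
    intro w hw
    by_cases hww : w = w₀
    · rw [hww]; simp only [σ, dslope_same]; exact deriv_exteriorInv_ne_zero hE h hw₀1
    · simp only [σ, dslope_of_ne _ hww, slope, vsub_eq_sub, smul_eq_mul]
      refine mul_ne_zero (inv_ne_zero (sub_ne_zero.2 hww)) (sub_ne_zero.2 fun he => hww ?_)
      exact exteriorInv_injOn h hw.1 hw₀1 he
  -- the integrand is `q w / (w - w₀)` with `q` holomorphic and `q w₀ = H z`
  set q : ℂ → ℂ := fun w => pullback E H w / σ w
  have hqA : DifferentiableOn ℂ q A := hgA.div hσA hσne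
  have hq₀ : q w₀ = H z := by
    simp only [q, σ, dslope_same, pullback, hψw₀]
    exact mul_div_cancel_right₀ _ (deriv_exteriorInv_ne_zero hE h hw₀1)
  set D := dslope q w₀
  have hDA : DifferentiableOn ℂ D A := (Complex.differentiableOn_dslope (hAo.mem_nhds hw₀A)).2 hqA
  have hsplit : ∀ w ∈ A, w ≠ w₀ →
      pullback E H w * (exteriorInv E w - z)⁻¹ = D w + H z * (w - w₀)⁻¹ := by
    intro w hw hne
    have h1 : w - w₀ ≠ 0 := sub_ne_zero.2 hne
    have h2 : exteriorInv E w - z = (w - w₀) * σ w := by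
      rw [← hψw₀]; simpa [smul_eq_mul] using (sub_smul_dslope (exteriorInv E) w₀ w).symm
    have h3 : q w - H z = (w - w₀) * D w := by
      rw [← hq₀]; simpa [smul_eq_mul] using (sub_smul_dslope q w₀ w).symm
    have h4 := hσne w hw
    have h5 : pullback E H w = q w * σ w := (div_mul_cancel₀ _ h4).symm
    rw [h2, h5]
    have h6 : q w = H z + (w - w₀) * D w := by rw [← h3]; ring
    rw [h6]
    field_simp
    ring
  have hcirc : ∀ r, 1 < r → ENNReal.ofReal r < ρ → r ≠ ‖w₀‖ →
      (∮ w in C(0, r), pullback E H w * (exteriorInv E w - z)⁻¹) =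
        (∮ w in C(0, r), D w) + H z * ∮ w in C(0, r), (w - w₀)⁻¹ := by
    intro r hr hrρ hrw
    have hS : ∀ w ∈ Metric.sphere (0 : ℂ) r, w ∈ A ∧ w ≠ w₀ := fun w hw => by
      rw [mem_sphere_zero_iff_norm] at hw
      refine ⟨⟨by rwa [hw], by rwa [hw]⟩, ?_⟩
      rintro rfl
      exact hrw hw.symm
    have hr0 : 0 ≤ r := (one_pos.trans hr).le
    have hi1 : CircleIntegrable D 0 r :=
      ContinuousOn.circleIntegrable hr0 (hDA.continuousOn.mono fun w hw => (hS w hw).1)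
    have hi2 : CircleIntegrable (fun w => H z * (w - w₀)⁻¹) 0 r := by
      refine ContinuousOn.circleIntegrable hr0 (continuousOn_const.mul ?_)
      exact (continuousOn_id.sub continuousOn_const).inv₀ fun w hw => sub_ne_zero.2 (hS w hw).2
    rw [circleIntegral.integral_congr hr0 (g := fun w => D w + H z * (w - w₀)⁻¹)
      fun w hw => hsplit w (hS w hw).1 (hS w hw).2, circleIntegral.integral_add hi1 hi2,
      circleIntegral.integral_const_mul]
  have hr₀₁ : r₀ < r₁ := hz₀.trans hz₁
  rw [hcirc r₁ (hr₀.trans hr₀₁) hr₁ρ hz₁.ne', hcirc r₀ hr₀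
    ((ENNReal.ofReal_le_ofReal hr₀₁.le).trans_lt hr₁ρ) hz₀.ne]
  have hann : (∮ w in C(0, r₁), D w) = ∮ w in C(0, r₀), D w := by
    have hsub : Metric.closedBall (0 : ℂ) r₁ \ Metric.ball 0 r₀ ⊆ A := by
      intro w hw
      have h1 : ‖w‖ ≤ r₁ := mem_closedBall_zero_iff.1 hw.1
      have h2 : r₀ ≤ ‖w‖ := by simpa using hw.2
      exact ⟨hr₀.trans_le h2, (ENNReal.ofReal_le_ofReal h1).trans_lt hr₁ρ⟩
    refine Complex.circleIntegral_eq_of_differentiable_on_annulus_off_countable (one_pos.trans hr₀)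
      hr₀₁.le countable_empty (hDA.continuousOn.mono hsub) fun w hw => ?_
    refine hDA.differentiableAt (hAo.mem_nhds (hsub ⟨Metric.ball_subset_closedBall hw.1.1, ?_⟩))
    exact fun h' => hw.1.2 (Metric.ball_subset_closedBall h')
  have hin : (∮ w in C(0, r₁), (w - w₀)⁻¹) = 2 * Real.pi * Complex.I :=
    circleIntegral.integral_sub_inv_of_mem_ball (by simpa using hz₁)
  have hout : (∮ w in C(0, r₀), (w - w₀)⁻¹) = 0 := by
    refine Complex.circleIntegral_eq_zero_of_differentiable_on_off_countable
      (one_pos.trans hr₀).le countable_empty ?_ ?_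
    · refine (continuousOn_id.sub continuousOn_const).inv₀ fun w hw => sub_ne_zero.2 ?_
      have h1 : ‖w‖ ≤ r₀ := mem_closedBall_zero_iff.1 hw
      exact fun he => absurd (show w = w₀ from he) fun he => by rw [he] at h1; linarith
    · rintro w ⟨hw, -⟩
      refine (differentiableAt_id.sub_const _).inv (sub_ne_zero.2 ?_)
      have h1 : ‖w‖ < r₀ := mem_ball_zero_iff.1 hw
      exact fun he => absurd (show w = w₀ from he) fun he => by rw [he] at h1; linarith
  rw [hann, hin, hout]
  ring

/-- The Cauchy formula on the level curve `|Φ| = r`. The difference of the two sides extends, by the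
jump relation, to an entire function that vanishes at infinity. -/
theorem cauchy_formula (hE : IsCompact E) (h : IsExteriorMap E (exteriorMap E))
    {ρ : ℝ≥0∞} (hρ : 1 < ρ) {H : ℂ → ℂ} (hH : DifferentiableOn ℂ H (canonicalDomain E ρ)) {r : ℝ}
    (hr : 1 < r) (hrρ : ENNReal.ofReal r < ρ) {z : ℂ}
    (hz : z ∈ canonicalDomain E (ENNReal.ofReal r)) :
    H z = (2 * Real.pi * Complex.I)⁻¹ *
      ∫ θ in Ioc 0 (2 * Real.pi), levelDensity E H r θ / (levelCurve E r θ - z) := by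
  obtain ⟨r₀, hr₀, hr₀r⟩ := exists_between hr
  have hr₀ρ : ENNReal.ofReal r₀ < ρ := (ENNReal.ofReal_le_ofReal hr₀r.le).trans_lt hrρ
  set c : ℂ := (2 * Real.pi * Complex.I)⁻¹
  have hc : c * (2 * Real.pi * Complex.I) = 1 := inv_mul_cancel₀ Complex.two_pi_I_ne_zero
  set J : ℝ → ℂ → ℂ := fun s y =>
    ∫ θ in Ioc 0 (2 * Real.pi), levelDensity E H s θ / (levelCurve E s θ - y) with hJ
  have hJdiff : ∀ s, 1 < s → ENNReal.ofReal s < ρ → ∀ y, ¬ (y ∉ E ∧ ‖exteriorMap E y‖ = s) →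
      DifferentiableAt ℂ (J s) y := fun s hs hsρ y hy =>
    differentiableAt_cauchyType (isCompact_level hE h hs)
      (continuous_levelCurve hE h hs).aestronglyMeasurable
      (Eventually.of_forall fun θ => levelCurve_spec h hs θ)
      (integrable_levelDensity hE h hρ hH hs hsρ) hy
  have hjump : ∀ y, y ∉ E → r₀ < ‖exteriorMap E y‖ → ‖exteriorMap E y‖ < r →
      H y - c * J r y = - (c * J r₀ y) := by
    intro y hyE hy₀ hy₁
    have h1 := cauchyType_jump hE h hρ hH hr₀ hrρ hyE hy₀ hy₁
    rw [circleIntegral_pullback H r fun ζ => (ζ - y)⁻¹,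
      circleIntegral_pullback H r₀ fun ζ => (ζ - y)⁻¹] at h1
    have h2 : J r y - J r₀ y = 2 * Real.pi * Complex.I * H y := by
      simpa only [hJ, div_eq_mul_inv] using h1
    have h3 : c * (J r y - J r₀ y) = H y := by rw [h2, ← mul_assoc, hc, one_mul]
    rw [← h3]; ring
  classical
  set Dr := canonicalDomain E (ENNReal.ofReal r) with hDr
  have hDo : IsOpen Dr := isOpen_canonicalDomain hE h (one_lt_ofReal.2 hr)
  set K : ℂ → ℂ := fun y => if y ∈ Dr then H y - c * J r y else - (c * J r₀ y) with hK
  have hKout : ∀ y, y ∉ E → r₀ < ‖exteriorMap E y‖ → K y = - (c * J r₀ y) := by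
    intro y hyE hy
    simp only [hK]
    split_ifs with hyD
    · exact hjump y hyE hy ((mem_canonicalDomain_ofReal hyE).1 hyD)
    · rfl
  have hKdiff : Differentiable ℂ K := by
    intro y
    by_cases hyD : y ∈ Dr
    · have hd : DifferentiableAt ℂ (fun y => H y - c * J r y) y := by
        refine (hH.differentiableAt ((isOpen_canonicalDomain hE h hρ).mem_nhds
          (canonicalDomain_mono hrρ.le hyD))).sub ((hJdiff r hr hrρ y ?_).const_mul c)
        rintro ⟨hyE, he⟩
        exact absurd ((mem_canonicalDomain_ofReal hyE).1 hyD) he.not_lt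
      refine hd.congr_of_eventuallyEq ?_
      filter_upwards [hDo.mem_nhds hyD] with x hx
      simp only [hK, if_pos hx]
    · have hyE : y ∉ E := fun h' => hyD (Or.inl h')
      have hy : r ≤ ‖exteriorMap E y‖ := not_lt.1 fun h' => hyD
          ((mem_canonicalDomain_ofReal hyE).2 h')
      have hd : DifferentiableAt ℂ (fun y => - (c * J r₀ y)) y := by
        refine ((hJdiff r₀ hr₀ hr₀ρ y ?_).const_mul c).neg
        rintro ⟨-, he⟩
        linarith
      refine hd.congr_of_eventuallyEq ?_
      filter_upwards [(isOpen_lt_norm_exteriorMap hE h r₀).mem_nhds ⟨hyE,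
          hr₀r.trans_le hy⟩] with x hx
      exact hKout x hx.1 hx.2
  have hKlim : Tendsto K (cocompact ℂ) (𝓝 0) := by
    obtain ⟨B, hB⟩ := (isCompact_level hE h hr₀).isBounded.exists_norm_le
    have h1 : Tendsto (J r₀) (cocompact ℂ) (𝓝 0) :=
      tendsto_cauchyType (Eventually.of_forall fun θ => hB _ (levelCurve_spec h hr₀ θ))
        (integrable_levelDensity hE h hρ hH hr₀ hr₀ρ)
    have h2 : Tendsto (fun y => - (c * J r₀ y)) (cocompact ℂ) (𝓝 0) := by
      simpa using (h1.const_mul c).neg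
    refine h2.congr' ?_
    filter_upwards [hE.compl_mem_cocompact,
      (tendsto_norm_cocompact_atTop.comp h.map_infty).eventually_gt_atTop r₀] with y hy1 hy2
    exact (hKout y hy1 hy2).symm
  have hK0 : K z = 0 := hKdiff.apply_eq_of_tendsto_cocompact z hKlim
  simp only [hK, if_pos hz] at hK0
  exact sub_eq_zero.1 hK0

variable {μ : Measure ℂ}

/-- The Cauchy formula integrated against `φ dμ`. -/
theorem integral_mul_eq_level (hE : IsCompact E) (h : IsExteriorMap E (exteriorMap E))
    [IsFiniteMeasure μ] (hμE : ∀ᵐ z ∂μ, z ∈ E)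
    {ρ : ℝ≥0∞} (hρ : 1 < ρ) {H : ℂ → ℂ} (hH : DifferentiableOn ℂ H (canonicalDomain E ρ)) {r : ℝ}
    (hr : 1 < r) (hrρ : ENNReal.ofReal r < ρ) {φ : ℂ → ℂ} (hφ : ContinuousOn φ E) :
    ∫ z, H z * φ z ∂μ = (2 * Real.pi * Complex.I)⁻¹ *
      ∫ θ in Ioc 0 (2 * Real.pi), levelDensity E H r θ * ∫ z, φ z / (levelCurve E r θ - z) ∂μ := by
  have h1 : ∫ z, H z * φ z ∂μ = ∫ z, ((2 * Real.pi * Complex.I)⁻¹ *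
      ∫ θ in Ioc 0 (2 * Real.pi), levelDensity E H r θ * (φ z / (levelCurve E r θ - z))) ∂μ := by
    refine integral_congr_ae ?_
    filter_upwards [hμE] with z hz
    rw [cauchy_formula hE h hρ hH hr hrρ (z := z) (Or.inl hz), mul_assoc, ← integral_mul_const]
    congr 2
    ext θ
    ring
  rw [h1, integral_const_mul]
  congr 1
  have h2 : Integrable (Function.uncurry fun (z : ℂ) (θ : ℝ) =>
      levelDensity E H r θ * (φ z / (levelCurve E r θ - z)))
      (μ.prod (volume.restrict (Ioc 0 (2 * Real.pi)))) := by
    rw [← Measure.restrict_eq_self_of_ae_mem hμE, Measure.prod_restrict]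
    refine IntegrableOn.mono_set (t := E ×ˢ Icc 0 (2 * Real.pi)) ?_
      (prod_mono subset_rfl Ioc_subset_Icc_self)
    refine ContinuousOn.integrableOn_compact (hE.prod isCompact_Icc) ?_
    refine ((continuous_levelDensity hE h hρ hH hr hrρ).comp continuous_snd).continuousOn.mul ?_
    refine (hφ.comp continuousOn_fst fun x hx => hx.1).div
      ((((continuous_levelCurve hE h hr).comp continuous_snd).sub continuous_fst).continuousOn) ?_
    rintro ⟨z, θ⟩ hx
    refine sub_ne_zero.2 fun he => (levelCurve_spec h hr θ).1 ?_
    simp only at he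
    rw [he]
    exact hx.1
  rw [integral_integral_swap h2]
  simp only [integral_const_mul]

end CauchyFormula

/-! ### Fourier coefficients with respect to orthonormal polynomials -/

theorem exists_bound_of_eventually {f : ℕ → ℝ} {C q : ℝ} (hq : 0 < q)
    (hf : ∀ᶠ n in atTop, ‖f n‖ ≤ C * q ^ n) : ∃ C', 0 < C' ∧ ∀ n, f n ≤ C' * q ^ n := by
  have h1 : f =O[atTop] fun n => q ^ n := Asymptotics.IsBigO.of_bound C (by
    filter_upwards [hf] with n hn
    rwa [Real.norm_of_nonneg (pow_pos hq n).le])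
  obtain ⟨C', hC', hb⟩ := Asymptotics.bound_of_isBigO_nat_atTop h1
  refine ⟨C', hC', fun n => (le_abs_self _).trans ?_⟩
  have := hb (x := n) (pow_pos hq n).ne'
  rwa [Real.norm_of_nonneg (pow_pos hq n).le, Real.norm_eq_abs] at this

/-- The `n`-th Fourier coefficient `⟨f, p_n⟩_μ`. -/
def fourierCoef (μ : Measure ℂ) (f : ℂ → ℂ) (n : ℕ) : ℂ := ip μ f fun z => (orthoPoly μ n).eval z

section Fourier

variable {E : Set ℂ} {μ : Measure ℂ}

theorem IsMeasureOn.ae_mem (hμ : IsMeasureOn E μ) : ∀ᵐ z ∂μ, z ∈ E := by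
  have := hμ.finite
  filter_upwards [Measure.support_mem_ae (μ := μ)] with z hz using hμ.support_subset hz

theorem IsMeasureOn.integrable (hE : IsCompact E) (hμ : IsMeasureOn E μ) {f : ℂ → ℂ}
    (hf : ContinuousOn f E) : Integrable f μ := by
  have := hμ.finite
  rw [← Measure.restrict_eq_self_of_ae_mem hμ.ae_mem]
  exact hf.integrableOn_compact hE

theorem continuousOn_conj_eval (P : ℂ[X]) : ContinuousOn (fun z => conj (P.eval z)) E :=
  (Complex.continuous_conj.comp P.continuous).continuousOn

theorem fourierCoef_congr (hμ : IsMeasureOn E μ) {f g : ℂ → ℂ} (hfg : EqOn f g E) (n : ℕ) :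
    fourierCoef μ f n = fourierCoef μ g n := by
  refine integral_congr_ae ?_
  filter_upwards [hμ.ae_mem] with z hz
  rw [hfg hz]

theorem fourierCoef_sub (hE : IsCompact E) (hμ : IsMeasureOn E μ) {f g : ℂ → ℂ}
    (hf : ContinuousOn f E) (hg : ContinuousOn g E) (n : ℕ) :
    fourierCoef μ (fun z => f z - g z) n = fourierCoef μ f n - fourierCoef μ g n := by
  simp only [fourierCoef, ip, sub_mul]
  exact integral_sub (hμ.integrable hE (hf.mul (continuousOn_conj_eval _)))
    (hμ.integrable hE (hg.mul (continuousOn_conj_eval _)))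

theorem fourierCoef_const_mul (c : ℂ) (f : ℂ → ℂ) (n : ℕ) :
    fourierCoef μ (fun z => c * f z) n = c * fourierCoef μ f n := by
  simp only [fourierCoef, ip, mul_assoc]
  exact integral_const_mul _ _

theorem fourierCoef_sum (hE : IsCompact E) (hμ : IsMeasureOn E μ) {ι : Type*} (s : Finset ι)
    {f : ι → ℂ → ℂ} (hf : ∀ i ∈ s, ContinuousOn (f i) E) (n : ℕ) :
    fourierCoef μ (fun z => ∑ i ∈ s, f i z) n = ∑ i ∈ s, fourierCoef μ (f i) n := by
  simp only [fourierCoef, ip, Finset.sum_mul]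
  exact integral_finsetSum _ fun i hi => hμ.integrable hE ((hf i hi).mul (continuousOn_conj_eval _))

theorem fourierCoef_eval_mul (hE : IsCompact E) (hμ : IsMeasureOn E μ) {f : ℂ → ℂ}
    (hf : ContinuousOn f E) {P : ℂ[X]} {d : ℕ} (hP : P.natDegree ≤ d) (n : ℕ) :
    fourierCoef μ (fun z => P.eval z * f z) n =
      ∑ i ∈ Finset.range (d + 1), P.coeff i * fourierCoef μ (fun z => z ^ i * f z) n := by
  simp_rw [← fourierCoef_const_mul]
  rw [← fourierCoef_sum hE hμ _ (f := fun i z => P.coeff i * (z ^ i * f z)) fun i _ =>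
    continuousOn_const.mul ((continuousOn_id.pow i).mul hf)]
  congr 1
  ext z
  rw [eval_eq_sum_range' (Nat.lt_succ_of_le hP), Finset.sum_mul]
  exact Finset.sum_congr rfl fun i _ => by ring

theorem fourierCoef_orthoPoly (hE : IsCompact E) (hμ : IsMeasureOn E μ) (k n : ℕ) :
    fourierCoef μ (fun z => (orthoPoly μ k).eval z) n = if k = n then 1 else 0 :=
  (orthoPoly_spec hE hμ).orthonormal k n

theorem orthoPoly_leadingCoeff (hE : IsCompact E) (hμ : IsMeasureOn E μ) (n : ℕ) :
    0 < kappa μ n ∧ (orthoPoly μ n).leadingCoeff = kappa μ n := by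
  obtain ⟨κ, hκ, he⟩ := (orthoPoly_spec hE hμ).leadingCoeff_pos n
  rw [kappa, he]
  exact ⟨by simpa using hκ, by simp⟩

/-- Subtracting a multiple of `p_n` lowers the degree. -/
theorem degree_sub_orthoPoly_lt (hE : IsCompact E) (hμ : IsMeasureOn E μ) {P : ℂ[X]} {n : ℕ}
    (hP : P.degree < (n + 1 : ℕ)) :
    (P - C (P.coeff n / kappa μ n) * orthoPoly μ n).degree < n := by
  obtain ⟨hκ, hlc⟩ := orthoPoly_leadingCoeff hE hμ n
  have hdeg := (orthoPoly_spec hE hμ).natDegree_eq n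
  have hκ' : (kappa μ n : ℂ) ≠ 0 := by exact_mod_cast hκ.ne'
  rw [degree_lt_iff_coeff_zero]
  intro k hk
  rw [coeff_sub, coeff_C_mul]
  rcases hk.eq_or_lt with rfl | hlt
  · have : (orthoPoly μ n).coeff n = kappa μ n := by
      rw [← hlc, leadingCoeff, hdeg]
    rw [this, div_mul_cancel₀ _ hκ', sub_self]
  · rw [(degree_lt_iff_coeff_zero _ _).1 hP k hlt,
      coeff_eq_zero_of_natDegree_lt (p := orthoPoly μ n) (by rw [hdeg]; exact hlt)]
    simp

theorem exists_eq_sum_orthoPoly (hE : IsCompact E) (hμ : IsMeasureOn E μ) (n : ℕ) :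
    ∀ P : ℂ[X], P.degree < n → ∃ c : ℕ → ℂ, P = ∑ k ∈ Finset.range n, C (c k) * orthoPoly μ k := by
  induction n with
  | zero =>
    intro P hP
    exact ⟨0, by simpa [Nat.WithBot.lt_zero_iff] using hP⟩
  | succ n ih =>
    intro P hP
    obtain ⟨c, hc⟩ := ih _ (degree_sub_orthoPoly_lt hE hμ hP)
    refine ⟨fun k => if k = n then P.coeff n / kappa μ n else c k, ?_⟩
    simp only [Finset.sum_range_succ, if_true]
    rw [← sub_eq_iff_eq_add, hc]
    refine Finset.sum_congr rfl fun k hk => ?_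
    rw [if_neg (Finset.mem_range.1 hk).ne]

theorem fourierCoef_eq_zero_of_degree_lt (hE : IsCompact E) (hμ : IsMeasureOn E μ) {P : ℂ[X]}
    {n : ℕ} (hP : P.degree < n) : fourierCoef μ (fun z => P.eval z) n = 0 := by
  obtain ⟨c, hc⟩ := exists_eq_sum_orthoPoly hE hμ n P hP
  have : (fun z => P.eval z) =
      fun z => ∑ k ∈ Finset.range n, c k * (orthoPoly μ k).eval z := by
    ext z
    conv_lhs => rw [hc]
    simp [eval_finsetSum]
  rw [this, fourierCoef_sum hE hμ _ (f := fun k z => c k * (orthoPoly μ k).eval z) fun k _ =>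
    continuousOn_const.mul (orthoPoly μ k).continuous.continuousOn]
  refine Finset.sum_eq_zero fun k hk => ?_
  rw [fourierCoef_const_mul, fourierCoef_orthoPoly hE hμ, if_neg (Finset.mem_range.1 hk).ne,
      mul_zero]

theorem fourierCoef_of_degree_lt_succ (hE : IsCompact E) (hμ : IsMeasureOn E μ) {P : ℂ[X]}
    {n : ℕ} (hP : P.degree < (n + 1 : ℕ)) :
    fourierCoef μ (fun z => P.eval z) n = P.coeff n / kappa μ n := by
  have h1 := fourierCoef_eq_zero_of_degree_lt hE hμ (degree_sub_orthoPoly_lt hE hμ hP)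
  simp only [eval_sub, eval_mul, eval_C] at h1
  rw [fourierCoef_sub hE hμ (g := fun z => P.coeff n / kappa μ n * (orthoPoly μ n).eval z)
    P.continuous.continuousOn
    (continuousOn_const.mul (orthoPoly μ n).continuous.continuousOn), fourierCoef_const_mul,
    fourierCoef_orthoPoly hE hμ, if_pos rfl, mul_one] at h1
  exact sub_eq_zero.1 h1

theorem moment_eq_zero (hE : IsCompact E) (hμ : IsMeasureOn E μ) {f : ℂ → ℂ}
    (hf : ContinuousOn f E) (h0 : ∀ n, fourierCoef μ f n = 0) (k : ℕ) :
    ∫ z, conj (f z) * z ^ k ∂μ = 0 := by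
  obtain ⟨c, hc⟩ := exists_eq_sum_orthoPoly hE hμ (k + 1) (X ^ k)
    (by rw [degree_X_pow]; exact_mod_cast Nat.lt_succ_self k)
  have h1 : ∀ z, conj (f z) * z ^ k =
      ∑ j ∈ Finset.range (k + 1), c j * conj (f z * conj ((orthoPoly μ j).eval z)) := by
    intro z
    have : z ^ k = ∑ j ∈ Finset.range (k + 1), c j * (orthoPoly μ j).eval z := by
      have := congrArg (eval z) hc
      simpa [eval_finsetSum] using this
    rw [this, Finset.mul_sum]
    refine Finset.sum_congr rfl fun j _ => ?_
    simp only [map_mul, Complex.conj_conj]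
    ring
  simp_rw [h1]
  rw [integral_finsetSum]
  · refine Finset.sum_eq_zero fun j _ => ?_
    rw [integral_const_mul, integral_conj]
    have := h0 j
    rw [fourierCoef, ip] at this
    rw [this]
    simp
  · intro j _
    refine hμ.integrable hE (continuousOn_const.mul ?_)
    exact Complex.continuous_conj.comp_continuousOn (hf.mul (continuousOn_conj_eval _))

theorem rpow_one_div_le {x q : ℝ} (hx : 0 ≤ x) {n : ℕ} (hn : n ≠ 0)
    (h : x ^ (1 / (n : ℝ)) ≤ q) : x ≤ q ^ n := by
  rw [one_div] at h
  calc x = (x ^ ((n : ℝ)⁻¹)) ^ n := (Real.rpow_inv_natCast_pow hx hn).symm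
    _ ≤ q ^ n := pow_le_pow_left₀ (Real.rpow_nonneg hx _) h n

/-- If the measure is regular, the exterior map exists: the default value `0` of `exteriorMap` would
force the orthonormal polynomials to tend to `0` uniformly on `E`. -/
theorem IsReg12.isExteriorMap (hE : IsCompact E) (hμ : IsReg12 E μ) :
    IsExteriorMap E (exteriorMap E) := by
  classical
  by_cases hex : ∃ Φ, IsExteriorMap E Φ
  · rw [exteriorMap, dif_pos hex]; exact hex.choose_spec
  exfalso
  have h0 : exteriorMap E = 0 := by rw [exteriorMap, dif_neg hex]
  have hfin := hμ.isMeasureOn.finite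
  obtain ⟨B, hB0, hB⟩ : ∃ B, 0 < B ∧ ∀ z ∈ E, ‖z‖ < B := by
    obtain ⟨B, hB⟩ := hE.isBounded.exists_norm_le
    exact ⟨|B| + 1, by positivity, fun z hz => by have := hB z hz; have := le_abs_self B; linarith⟩
  have hK : Metric.sphere (0 : ℂ) B ⊆ Eᶜ := fun z hz hzE => by
    have := hB z hzE; rw [mem_sphere_zero_iff_norm] at hz; linarith
  have h1 := Metric.tendstoUniformlyOn_iff.1 (hμ.reg1 _ (isCompact_sphere _ _) hK) (1 / 2)
      (by norm_num)
  have hle : ∀ᶠ n : ℕ in atTop, (1 : ℝ) ≤ ((1 / 2) ^ n) ^ 2 * μ.real univ := by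
    filter_upwards [h1, eventually_ge_atTop 1] with n hn hn1
    have hsph : ∀ z ∈ Metric.sphere (0 : ℂ) B, ‖(orthoPoly μ n).eval z‖ ≤ (1 / 2) ^ n :=
        fun z hz => by
      refine rpow_one_div_le (norm_nonneg _) (by omega) ?_
      have := hn z hz
      simp only [h0, Pi.zero_apply, norm_zero, dist_zero_left] at this
      exact (le_abs_self _).trans this.le
    have hball : ∀ z ∈ E, ‖(orthoPoly μ n).eval z‖ ≤ (1 / 2) ^ n := fun z hz => by
      refine Complex.norm_le_of_forall_mem_frontier_norm_le (U := Metric.ball (0 : ℂ) B)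
        Metric.isBounded_ball (orthoPoly μ n).differentiable.diffContOnCl ?_
        (subset_closure (mem_ball_zero_iff.2 (hB z hz)))
      rw [frontier_ball _ hB0.ne']
      exact hsph
    have h2 := fourierCoef_orthoPoly hE hμ.isMeasureOn n n
    rw [if_pos rfl, fourierCoef, ip] at h2
    have h3 := norm_integral_le_of_norm_le_const (μ := μ) (C := ((1 / 2 : ℝ) ^ n) ^ 2)
      (f := fun z => (orthoPoly μ n).eval z * conj ((orthoPoly μ n).eval z)) (by
        filter_upwards [hμ.isMeasureOn.ae_mem] with z hz
        rw [norm_mul, RCLike.norm_conj, ← sq]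
        exact pow_le_pow_left₀ (norm_nonneg _) (hball z hz) 2)
    rw [h2] at h3
    simpa using h3
  have hlim : Tendsto (fun n : ℕ => (((1 : ℝ) / 2) ^ n) ^ 2 * μ.real univ) atTop (𝓝 0) := by
    have := (((tendsto_pow_atTop_nhds_zero_of_lt_one (r := (1 / 2 : ℝ)) (by norm_num)
      (by norm_num))).pow 2).mul_const (μ.real univ)
    simpa using this
  have := ge_of_tendsto hlim hle
  norm_num at this

theorem eventually_norm_secondType_le (hE : IsCompact E) (hμ : IsReg12 E μ) {r q : ℝ} (hr : 1 < r)
    (hq : r⁻¹ < q) :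
    ∀ᶠ n in atTop, ∀ z, z ∉ E → ‖exteriorMap E z‖ = r → ‖secondType μ n z‖ ≤ q ^ n := by
  have h1 := Metric.tendstoUniformlyOn_iff.1 (hμ.reg2 _
    (isCompact_level hE (hμ.isExteriorMap hE) hr) fun z hz => hz.1) (q - r⁻¹) (sub_pos.2 hq)
  filter_upwards [h1, eventually_ge_atTop 1] with n hn hn1 z hzE hz
  refine rpow_one_div_le (norm_nonneg _) (by omega) ?_
  have h2 := hn z ⟨hzE, hz⟩
  rw [hz, Real.dist_eq, abs_lt] at h2
  linarith [h2.1]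

theorem exists_norm_orthoPoly_le (hE : IsCompact E) (hμ : IsReg12 E μ) {r q : ℝ} (hr : 1 < r)
    (hq : r < q) :
    ∃ C, 0 < C ∧ ∀ n, ∀ z ∈ canonicalDomain E (ENNReal.ofReal r),
      ‖(orthoPoly μ n).eval z‖ ≤ C * q ^ n := by
  classical
  have h := hμ.isExteriorMap hE
  have h1 := Metric.tendstoUniformlyOn_iff.1 (hμ.reg1 _ (isCompact_level hE h hr) fun z hz => hz.1)
    (q - r) (sub_pos.2 hq)
  have h2 : ∀ᶠ n in atTop, ∀ z ∈ {z | z ∉ E ∧ ‖exteriorMap E z‖ = r},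
      ‖(orthoPoly μ n).eval z‖ ≤ q ^ n := by
    filter_upwards [h1, eventually_ge_atTop 1] with n hn hn1 z hz
    refine rpow_one_div_le (norm_nonneg _) (by omega) ?_
    have h2 := hn z hz
    rw [hz.2, Real.dist_eq, abs_lt] at h2
    linarith [h2.1]
  have h3 : ∀ n, ∃ M, 0 ≤ M ∧ ∀ z ∈ {z | z ∉ E ∧ ‖exteriorMap E z‖ = r},
      ‖(orthoPoly μ n).eval z‖ ≤ M := fun n => by
    obtain ⟨M, hM⟩ := (isCompact_level hE h hr).exists_bound_of_continuousOn
      (orthoPoly μ n).continuous.continuousOn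
    exact ⟨|M|, abs_nonneg _, fun z hz => (hM z hz).trans (le_abs_self _)⟩
  choose M hM0 hM using h3
  have hq0 : 0 < q := (one_pos.trans hr).trans hq
  obtain ⟨C, hC, hb⟩ := exists_bound_of_eventually (C := 1) hq0
    (f := fun n => if ∀ z ∈ {z | z ∉ E ∧ ‖exteriorMap E z‖ = r},
      ‖(orthoPoly μ n).eval z‖ ≤ q ^ n then q ^ n else M n) (by
    filter_upwards [h2] with n hn
    rw [if_pos hn, one_mul, Real.norm_of_nonneg (pow_pos hq0 n).le])
  refine ⟨C, hC, fun n z hz =>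
    norm_le_of_norm_le_on_level hE h hr (orthoPoly μ n).differentiable ?_ hz⟩
  intro y hyE hy
  refine le_trans ?_ (hb n)
  split_ifs with hc
  · exact hc y ⟨hyE, hy⟩
  · exact hM n y ⟨hyE, hy⟩

/-- Geometric decay of the Fourier coefficients of a function holomorphic on `D_ρ`: by the Cauchy
formula they are integrals of the second type functions over level curves. -/
theorem exists_norm_fourierCoef_le (hE : IsCompact E) (hμ : IsReg12 E μ) {ρ : ℝ≥0∞} (hρ : 1 < ρ)
    {H : ℂ → ℂ} (hH : DifferentiableOn ℂ H (canonicalDomain E ρ)) {q : ℝ} (hq : 0 < q)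
    (hqρ : ENNReal.ofReal q⁻¹ < ρ) : ∃ C, 0 < C ∧ ∀ n, ‖fourierCoef μ H n‖ ≤ C * q ^ n := by
  have h := hμ.isExteriorMap hE
  have hfin := hμ.isMeasureOn.finite
  obtain ⟨r, hr0, hr1, hrρ⟩ := ENNReal.lt_iff_exists_real_btwn.1 (max_lt hρ hqρ)
  have hr : 1 < r := one_lt_ofReal.1 ((le_max_left _ _).trans_lt hr1)
  have hqr : r⁻¹ < q := by
    have : q⁻¹ < r := (ENNReal.ofReal_lt_ofReal_iff'.1 ((le_max_right _ _).trans_lt hr1)).1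
    exact inv_lt_of_inv_lt₀ hq this
  refine exists_bound_of_eventually (C := ‖(2 * Real.pi * Complex.I)⁻¹‖ *
    ∫ θ in Ioc 0 (2 * Real.pi), ‖levelDensity E H r θ‖) hq ?_
  filter_upwards [eventually_norm_secondType_le hE hμ hr hqr] with n hn
  have h1 : fourierCoef μ H n = (2 * Real.pi * Complex.I)⁻¹ *
      ∫ θ in Ioc 0 (2 * Real.pi), levelDensity E H r θ * secondType μ n (levelCurve E r θ) :=
    integral_mul_eq_level hE h hμ.isMeasureOn.ae_mem hρ hH hr hrρ (continuousOn_conj_eval _)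
  rw [norm_norm, h1, norm_mul, mul_assoc _ (∫ θ in Ioc 0 (2 * Real.pi), ‖levelDensity E H r θ‖),
    ← integral_mul_const]
  gcongr
  refine norm_integral_le_of_norm_le ((integrable_levelDensity hE h hρ hH hr hrρ).norm.mul_const _)
    (Eventually.of_forall fun θ => ?_)
  rw [norm_mul]
  have := levelCurve_spec h hr θ
  gcongr
  exact hn _ this.1 this.2

theorem isPreconnected_compl (hE : IsCompact E) (h : IsExteriorMap E (exteriorMap E)) :
    IsPreconnected Eᶜ := by
  have he : Eᶜ = exteriorInv E '' {w | ‖w‖ ∈ Ioi 1} := by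
    ext z
    constructor
    · exact fun hz => ⟨exteriorMap E z, h.one_lt_norm hz, exteriorInv_exteriorMap h hz⟩
    · rintro ⟨w, hw, rfl⟩
      exact exteriorInv_notMem h hw
  rw [he]
  exact (isPreconnected_norm_preimage ordConnected_Ioi fun x (hx : 1 < x) =>
      one_pos.trans hx).image _
    fun w hw => (continuousAt_exteriorInv hE h hw).continuousWithinAt

/-- A Cauchy transform all of whose moments vanish is zero off `E`: it vanishes near infinity, and
the complement of `E` is connected. -/
theorem cauchyTransform_eq_zero (hE : IsCompact E) (h : IsExteriorMap E (exteriorMap E))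
    (hμ : IsMeasureOn E μ) {φ : ℂ → ℂ} (hφ : ContinuousOn φ E)
    (h0 : ∀ k : ℕ, ∫ z, φ z * z ^ k ∂μ = 0) {y : ℂ} (hy : y ∉ E) :
    ∫ z, φ z / (z - y) ∂μ = 0 := by
  have hfin := hμ.finite
  have hφi := hμ.integrable hE hφ
  obtain ⟨B, hB0, hB⟩ : ∃ B, 0 < B ∧ ∀ z ∈ E, ‖z‖ ≤ B := by
    obtain ⟨B, hB⟩ := hE.isBounded.exists_norm_le
    exact ⟨|B| + 1, by positivity, fun z hz => by have := hB z hz; have := le_abs_self B; linarith⟩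
  have hfar : ∀ a : ℂ, 2 * B < ‖a‖ → ∫ z, φ z / (z - a) ∂μ = 0 := by
    intro a ha
    have ha0 : a ≠ 0 := norm_pos_iff.1 (by linarith)
    have haE : a ∉ E := fun h' => by have := hB a h'; linarith
    -- peel off the first `N` terms of the expansion of `1 / (z - a)` in powers of `z / a`
    have hN : ∀ N : ℕ, ∫ z, φ z / (z - a) ∂μ = ∫ z, (φ z * (z / a) ^ N) / (z - a) ∂μ := by
      intro N
      induction N with
      | zero => simp
      | succ N ih =>
        rw [ih]
        have h1 : ∫ z, (φ z * (z / a) ^ N) / (z - a) ∂μ =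
            ∫ z, ((φ z * (z / a) ^ (N + 1)) / (z - a) - (a ^ (N + 1))⁻¹ * (φ z * z ^ N)) ∂μ := by
          refine integral_congr_ae ?_
          filter_upwards [hμ.ae_mem] with z hz
          have hza : z - a ≠ 0 := sub_ne_zero.2 fun h' => haE (h' ▸ hz)
          rw [div_pow, div_pow]
          field_simp
          ring
        rw [h1, integral_sub, integral_const_mul, h0 N, mul_zero, sub_zero]
        · refine hμ.integrable hE ((hφ.mul ((continuousOn_id.div_const a).pow _)).div
            (continuousOn_id.sub continuousOn_const) fun z hz => sub_ne_zero.2 ?_)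
          exact fun h' => haE (h' ▸ hz)
        · exact (hμ.integrable hE (hφ.mul (continuousOn_id.pow N))).const_mul _
    have hbound : ∀ N : ℕ, ‖∫ z, φ z / (z - a) ∂μ‖ ≤
        ((∫ z, ‖φ z‖ ∂μ) * (1 / 2) ^ N) / (‖a‖ - B) := by
      intro N
      rw [hN N]
      have hi : Integrable (fun z => φ z * (z / a) ^ N) μ :=
        hμ.integrable hE (hφ.mul ((continuousOn_id.div_const a).pow _))
      refine (norm_cauchyType_le (u := fun z => z) (B := B)
        (by filter_upwards [hμ.ae_mem] with z hz using hB z hz) hi (by linarith)).trans ?_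
      rw [← integral_mul_const]
      have : 0 < ‖a‖ - B := by linarith
      refine div_le_div_of_nonneg_right ?_ this.le
      refine integral_mono_ae hi.norm (hφi.norm.mul_const _) ?_
      filter_upwards [hμ.ae_mem] with z hz
      rw [norm_mul, norm_pow, norm_div]
      have : ‖z‖ / ‖a‖ ≤ 1 / 2 := by
        rw [div_le_iff₀ (norm_pos_iff.2 ha0)]
        have := hB z hz
        linarith
      gcongr
    have hlim : Tendsto (fun N : ℕ => ((∫ z, ‖φ z‖ ∂μ) * (1 / 2 : ℝ) ^ N) / (‖a‖ - B)) atTop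
        (𝓝 0) := by
      have := ((tendsto_pow_atTop_nhds_zero_of_lt_one (r := (1 / 2 : ℝ)) (by norm_num)
        (by norm_num)).const_mul (∫ z, ‖φ z‖ ∂μ)).div_const (‖a‖ - B)
      simpa using this
    exact norm_le_zero_iff.1 (ge_of_tendsto' hlim hbound)
  have hdiff : DifferentiableOn ℂ (fun y => ∫ z, φ z / (z - y) ∂μ) Eᶜ := fun y hy =>
    (differentiableAt_cauchyType (u := fun z => z) hE aestronglyMeasurable_id hμ.ae_mem hφi
      hy).differentiableWithinAt
  have hinf : ∀ᶠ a : ℂ in cocompact ℂ, 2 * B + 1 < ‖a‖ :=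
    tendsto_norm_cocompact_atTop.eventually_gt_atTop _
  obtain ⟨a, ha⟩ := hinf.exists
  have haE : a ∈ Eᶜ := fun h' => by have := hB a h'; linarith
  refine AnalyticOnNhd.eqOn_zero_of_preconnected_of_eventuallyEq_zero
    (hdiff.analyticOnNhd hE.isClosed.isOpen_compl)
    (isPreconnected_compl hE h) haE ?_ hy
  filter_upwards [(isOpen_lt continuous_const continuous_norm).mem_nhds
    (show 2 * B < ‖a‖ by linarith)] with b hb
  exact hfar b hb

/-- A holomorphic function on `D_ρ` with vanishing Fourier coefficients is zero: its conjugate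
annihilates polynomials, hence all Cauchy kernels with pole off `E`, hence by the Cauchy formula the
function itself. -/
theorem eqOn_zero_of_fourierCoef_eq_zero (hE : IsCompact E) (h : IsExteriorMap E (exteriorMap E))
    (hμ : IsMeasureOn E μ) {ρ : ℝ≥0∞} (hρ : 1 < ρ) {H : ℂ → ℂ}
    (hH : DifferentiableOn ℂ H (canonicalDomain E ρ)) (h0 : ∀ n, fourierCoef μ H n = 0) :
    EqOn H 0 (canonicalDomain E ρ) := by
  have hfin := hμ.finite
  have hHE : ContinuousOn H E := hH.continuousOn.mono subset_canonicalDomain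
  have hcE : ContinuousOn (fun z => conj (H z)) E := Complex.continuous_conj.comp_continuousOn hHE
  obtain ⟨r, -, hr1, hrρ⟩ := ENNReal.lt_iff_exists_real_btwn.1 hρ
  have hr := one_lt_ofReal.1 hr1
  -- the Cauchy formula integrated against `conj H` gives `∫ |H|² dμ`
  have h1 := integral_mul_eq_level hE h hμ.ae_mem hρ hH hr hrρ hcE
  have h2 : ∀ θ, ∫ z, conj (H z) / (levelCurve E r θ - z) ∂μ = 0 := fun θ => by
    have := cauchyTransform_eq_zero hE h hμ hcE (moment_eq_zero hE hμ hHE h0)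
      (levelCurve_spec h hr θ).1
    rw [← neg_eq_zero, ← integral_neg, ← this]
    refine integral_congr_ae (Eventually.of_forall fun z => ?_)
    simp only
    rw [← neg_sub (levelCurve E r θ) z, div_neg]
  simp only [h2, mul_zero, integral_zero] at h1
  have h3 : ∫ z, ‖H z‖ ^ 2 ∂μ = 0 := by
    have h4 : ∀ z, H z * conj (H z) = ((‖H z‖ ^ 2 : ℝ) : ℂ) := fun z => by
      rw [Complex.mul_conj, Complex.normSq_eq_norm_sq]
    simp only [h4] at h1
    rw [show (∫ z, ((‖H z‖ ^ 2 : ℝ) : ℂ) ∂μ) = ((∫ z, ‖H z‖ ^ 2 ∂μ : ℝ) : ℂ) from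
      integral_ofReal] at h1
    exact_mod_cast h1
  rw [integral_eq_zero_iff_of_nonneg (fun z => by positivity)] at h3
  · have hcl : IsClosed (E ∩ H ⁻¹' {0}) :=
      hHE.preimage_isClosed_of_isClosed hE.isClosed isClosed_singleton
    have hs : μ.support ⊆ E ∩ H ⁻¹' {0} := by
      refine Measure.support_subset_of_isClosed hcl ?_
      filter_upwards [h3, hμ.ae_mem] with z hz hzE
      exact ⟨hzE, by simpa using hz⟩
    obtain ⟨a, haE, hacc⟩ := (hμ.support_infinite.mono hs).exists_accPt_of_subset_isCompact hE
      inter_subset_left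
    refine eqOn_canonicalDomain hE h hρ hH (differentiableOn_const 0) (Or.inl haE) ?_
    exact (accPt_iff_frequently_nhdsNE.1 hacc).mono fun z hz => hz.2
  · have : Integrable (fun z => ((‖H z‖ ^ 2 : ℝ) : ℂ)) μ :=
      hμ.integrable hE (Complex.continuous_ofReal.comp_continuousOn (hHE.norm.pow 2))
    simpa only [RCLike.re_to_complex, Complex.ofReal_re] using this.re

theorem exists_summable_bound (hE : IsCompact E) (hμ : IsReg12 E μ) {a : ℕ → ℂ} {C q r : ℝ}
    (hq : 0 < q) (ha : ∀ n, ‖a n‖ ≤ C * q ^ n) (hr : 1 < r) (hqr : q * r < 1) :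
    ∃ u : ℕ → ℝ, Summable u ∧ ∀ n, ∀ z ∈ canonicalDomain E (ENNReal.ofReal r),
      ‖a n * (orthoPoly μ n).eval z‖ ≤ u n := by
  obtain ⟨s, hrs, hs⟩ : ∃ s, r < s ∧ q * s < 1 := by
    obtain ⟨s, h1, h2⟩ := exists_between ((lt_div_iff₀' hq).2 hqr)
    exact ⟨s, h1, (lt_div_iff₀' hq).1 h2⟩
  obtain ⟨M, hM0, hM⟩ := exists_norm_orthoPoly_le hE hμ hr hrs
  have hs0 : 0 < s := (one_pos.trans hr).trans hrs
  refine ⟨fun n => C * M * (q * s) ^ n,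
    (summable_geometric_of_lt_one (mul_pos hq hs0).le hs).mul_left _, fun n z hz => ?_⟩
  rw [norm_mul]
  calc ‖a n‖ * ‖(orthoPoly μ n).eval z‖ ≤ (C * q ^ n) * (M * s ^ n) :=
        mul_le_mul (ha n) (hM n z hz) (norm_nonneg _) ((norm_nonneg _).trans (ha n))
    _ = C * M * (q * s) ^ n := by rw [mul_pow]; ring

/-- Orthogonal series with geometrically decaying coefficients converge to holomorphic functions. -/
theorem differentiableOn_orthogonalSeries (hE : IsCompact E) (hμ : IsReg12 E μ) {a : ℕ → ℂ}
    {C q r : ℝ} (hq : 0 < q) (ha : ∀ n, ‖a n‖ ≤ C * q ^ n) (hr : 1 < r) (hqr : q * r < 1) :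
    DifferentiableOn ℂ (fun z => ∑' n, a n * (orthoPoly μ n).eval z)
      (canonicalDomain E (ENNReal.ofReal r)) := by
  have h := hμ.isExteriorMap hE
  obtain ⟨u, hu, hb⟩ := exists_summable_bound hE hμ hq ha hr hqr
  exact Complex.differentiableOn_tsum_of_summable_norm hu
    (fun n => ((orthoPoly μ n).differentiable.const_mul (a n)).differentiableOn)
    (isOpen_canonicalDomain hE h (one_lt_ofReal.2 hr)) hb

theorem hasSum_integral_orthogonalSeries (hE : IsCompact E) (hμ : IsReg12 E μ) {a : ℕ → ℂ}
    {C q r : ℝ} (hq : 0 < q) (ha : ∀ n, ‖a n‖ ≤ C * q ^ n) (hr : 1 < r) (hqr : q * r < 1)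
    {φ : ℂ → ℂ} (hφ : ContinuousOn φ E) :
    HasSum (fun k => a k * ∫ z, (orthoPoly μ k).eval z * φ z ∂μ)
      (∫ z, (∑' n, a n * (orthoPoly μ n).eval z) * φ z ∂μ) := by
  have hfin := hμ.isMeasureOn.finite
  obtain ⟨u, hu, hb⟩ := exists_summable_bound hE hμ hq ha hr hqr
  obtain ⟨B, hB⟩ := hE.exists_bound_of_continuousOn hφ
  have hint : ∀ k, Integrable (fun z => a k * (orthoPoly μ k).eval z * φ z) μ := fun k =>
    hμ.isMeasureOn.integrable hE
      ((continuousOn_const.mul (orthoPoly μ k).continuous.continuousOn).mul hφ)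
  have hHS := hasSum_integral_of_summable_integral_norm (μ := μ) hint (by
    refine Summable.of_nonneg_of_le (fun k => integral_nonneg fun z => norm_nonneg _)
      (fun k => ?_) (hu.mul_right (|B| * μ.real univ))
    have h5 := norm_integral_le_of_norm_le_const (μ := μ) (C := u k * |B|)
      (f := fun z => ‖a k * (orthoPoly μ k).eval z * φ z‖) (by
        filter_upwards [hμ.isMeasureOn.ae_mem] with z hz
        rw [norm_norm, norm_mul]
        exact mul_le_mul (hb k z (Or.inl hz)) ((hB z hz).trans (le_abs_self _)) (norm_nonneg _)
          ((norm_nonneg _).trans (hb k z (Or.inl hz))))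
    rw [← mul_assoc]
    exact (le_abs_self _).trans h5)
  simp only [tsum_mul_right] at hHS
  simpa only [← integral_const_mul, mul_assoc] using hHS

/-- A function holomorphic on `D_ρ` is the sum of its Fourier series, wherever its coefficients
decay fast enough for the series to converge. -/
theorem eqOn_fourierSeries (hE : IsCompact E) (hμ : IsReg12 E μ) {ρ : ℝ≥0∞}
    (hρ : 1 < ρ) {H : ℂ → ℂ} (hH : DifferentiableOn ℂ H (canonicalDomain E ρ)) {C q r : ℝ}
    (hq : 0 < q) (ha : ∀ n, ‖fourierCoef μ H n‖ ≤ C * q ^ n) (hr : 1 < r) (hqr : q * r < 1) :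
    EqOn (fun z => ∑' n, fourierCoef μ H n * (orthoPoly μ n).eval z) H
      (canonicalDomain E (min ρ (ENNReal.ofReal r))) := by
  have h := hμ.isExteriorMap hE
  have h1 := differentiableOn_orthogonalSeries hE hμ hq ha hr hqr
  have h2 : ∀ n, fourierCoef μ
      (fun z => ∑' n, fourierCoef μ H n * (orthoPoly μ n).eval z) n = fourierCoef μ H n := by
    intro n
    refine (hasSum_integral_orthogonalSeries hE hμ hq ha hr hqr
      (continuousOn_conj_eval (orthoPoly μ n))).unique ?_
    have hterm : ∀ k, fourierCoef μ H k *
        ∫ z, (orthoPoly μ k).eval z * conj ((orthoPoly μ n).eval z) ∂μ =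
          if k = n then fourierCoef μ H n else 0 := fun k => by
      have := fourierCoef_orthoPoly hE hμ.isMeasureOn k n
      rw [fourierCoef, ip] at this
      rw [this]
      split_ifs with hk
      · rw [hk, mul_one]
      · rw [mul_zero]
    simp only [hterm]
    exact hasSum_ite_eq n _
  have hm : 1 < min ρ (ENNReal.ofReal r) := lt_min hρ (one_lt_ofReal.2 hr)
  have h3 := eqOn_zero_of_fourierCoef_eq_zero hE h hμ.isMeasureOn hm
    ((h1.mono (canonicalDomain_mono (min_le_right _ _))).sub
      (hH.mono (canonicalDomain_mono (min_le_left _ _)))) fun n => by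
    have := fourierCoef_sub hE hμ.isMeasureOn (h1.continuousOn.mono subset_canonicalDomain)
      (hH.continuousOn.mono subset_canonicalDomain) n
    refine Eq.trans this ?_
    rw [h2 n, sub_self]
  exact fun z hz => sub_eq_zero.1 (h3 hz)

end Fourier

/-! ### The ideal of polynomials that clear the poles -/

section Ideal

variable {E : Set ℂ} {F : ℂ → ℂ}

/-- The polynomials `T` for which `T F` continues holomorphically from `E` to `D_ρ`. When `F`
continues to a function on `D_ρ` with finitely many poles, these are the multiples of the monic
polynomial whose zeros are the poles, with multiplicities. -/
def clearingIdeal (E : Set ℂ) (F : ℂ → ℂ) (ρ : ℝ≥0∞) : Ideal ℂ[X] where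
  carrier := {T | ∃ H, DifferentiableOn ℂ H (canonicalDomain E ρ) ∧
    H =ᶠ[𝓝ˢ E] fun z => T.eval z * F z}
  zero_mem' := ⟨0, differentiableOn_const 0, by simp; rfl⟩
  add_mem' := by
    rintro S T ⟨H₁, h₁, e₁⟩ ⟨H₂, h₂, e₂⟩
    refine ⟨fun z => H₁ z + H₂ z, h₁.add h₂, ?_⟩
    filter_upwards [e₁, e₂] with z h₁ h₂
    rw [h₁, h₂, eval_add, add_mul]
  smul_mem' := by
    rintro S T ⟨H, h, e⟩
    refine ⟨fun z => S.eval z * H z, S.differentiable.differentiableOn.mul h, ?_⟩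
    filter_upwards [e] with z h
    rw [h, smul_eq_mul, eval_mul, mul_assoc]

theorem clearingIdeal_anti {ρ ρ' : ℝ≥0∞} (hle : ρ ≤ ρ') :
    clearingIdeal E F ρ' ≤ clearingIdeal E F ρ := by
  rintro T ⟨H, h, e⟩
  exact ⟨H, h.mono (canonicalDomain_mono hle), e⟩

theorem eventually_of_eqOn_canonicalDomain (hE : IsCompact E)
    (h : IsExteriorMap E (exteriorMap E)) {ρ : ℝ≥0∞} (hρ : 1 < ρ) {f g : ℂ → ℂ}
    (hfg : EqOn f g (canonicalDomain E ρ)) : f =ᶠ[𝓝ˢ E] g :=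
  mem_of_superset ((isOpen_canonicalDomain hE h hρ).mem_nhdsSet.2 subset_canonicalDomain) hfg

theorem eqOn_of_eventuallyEq_nhdsSet (hE : IsCompact E) (hne : E.Nonempty)
    (h : IsExteriorMap E (exteriorMap E)) {ρ : ℝ≥0∞} (hρ : 1 < ρ) {f g : ℂ → ℂ}
    (hf : DifferentiableOn ℂ f (canonicalDomain E ρ))
    (hg : DifferentiableOn ℂ g (canonicalDomain E ρ)) (hfg : f =ᶠ[𝓝ˢ E] g) :
    EqOn f g (canonicalDomain E ρ) := by
  obtain ⟨a, ha⟩ := hne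
  have h1 : ∀ᶠ z in 𝓝[≠] a, f z = g z :=
    ((eventually_nhdsSet_iff_forall.1 hfg) a ha).filter_mono nhdsWithin_le_nhds
  exact eqOn_canonicalDomain hE h hρ hf hg (Or.inl ha) h1.frequently

theorem HolomorphicNear.analyticAt (hF : HolomorphicNear E F) {z : ℂ} (hz : z ∈ E) :
    AnalyticAt ℂ F z := by
  obtain ⟨U, hU, hEU, hd⟩ := hF
  exact hd.analyticAt (hU.mem_nhds (hEU hz))

theorem HolomorphicNear.continuousOn (hF : HolomorphicNear E F) : ContinuousOn F E :=
  fun _ hz => (hF.analyticAt hz).continuousAt.continuousWithinAt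

theorem HolomorphicNear.exists_one_mem (hE : IsCompact E) (h : IsExteriorMap E (exteriorMap E))
    (hF : HolomorphicNear E F) : ∃ r : ℝ, 1 < r ∧ (1 : ℂ[X]) ∈ clearingIdeal E F
    (ENNReal.ofReal r) := by
  obtain ⟨U, hU, hEU, hd⟩ := hF
  obtain ⟨r, hr, hsub⟩ := exists_canonicalDomain_subset hE h hU hEU
  exact ⟨r, hr, F, hd.mono hsub, by simp⟩

/-- A linear factor whose zero lies outside `D_ρ`, or is a zero of the continuation, is
superfluous. -/
theorem mem_clearingIdeal_of_mul (hE : IsCompact E) (h : IsExteriorMap E (exteriorMap E))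
    (hF : HolomorphicNear E F) {ρ : ℝ≥0∞} (hρ : 1 < ρ) {T : ℂ[X]} {α : ℂ} {H : ℂ → ℂ}
    (hH : DifferentiableOn ℂ H (canonicalDomain E ρ))
    (hHF : H =ᶠ[𝓝ˢ E] fun z => ((X - C α) * T).eval z * F z)
    (hα : α ∈ canonicalDomain E ρ → H α = 0) : T ∈ clearingIdeal E F ρ := by
  have hD := isOpen_canonicalDomain hE h hρ
  by_cases hαD : α ∈ canonicalDomain E ρ
  · refine ⟨dslope H α, (Complex.differentiableOn_dslope (hD.mem_nhds hαD)).2 hH, ?_⟩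
    refine eventually_nhdsSet_iff_forall.2 fun e he => ?_
    have hd1 : ContinuousAt (dslope H α) e :=
      (((Complex.differentiableOn_dslope (hD.mem_nhds hαD)).2 hH).differentiableAt
        (hD.mem_nhds (Or.inl he))).continuousAt
    have hd2 : ContinuousAt (fun z => T.eval z * F z) e :=
      T.continuous.continuousAt.mul (hF.analyticAt he).continuousAt
    have hnear := eventually_nhdsSet_iff_forall.1 hHF e he
    have hdiv : ∀ z, z ≠ α → H z = ((X - C α) * T).eval z * F z → dslope H α z =
        T.eval z * F z := by
      intro z hz hzF
      rw [dslope_of_ne _ hz, slope, vsub_eq_sub, smul_eq_mul, hα hαD, sub_zero, hzF]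
      simp only [eval_mul, eval_sub, eval_X, eval_C]
      have := sub_ne_zero.2 hz
      field_simp
    refine (hd1.eventuallyEq_nhds_iff_eventuallyEq_nhdsNE hd2).1 ?_
    by_cases hee : e = α
    · filter_upwards [hnear.filter_mono nhdsWithin_le_nhds, self_mem_nhdsWithin] with z hz hz'
      exact hdiv z (hee ▸ hz') hz
    · refine Filter.Eventually.filter_mono nhdsWithin_le_nhds ?_
      filter_upwards [hnear, isOpen_ne.mem_nhds hee] with z hz hz'
      exact hdiv z hz' hz
  · refine ⟨fun z => H z / (z - α), hH.div (differentiableOn_id.sub_const α) fun z hz =>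
      sub_ne_zero.2 fun he => hαD (he ▸ hz), ?_⟩
    filter_upwards [hHF, hD.mem_nhdsSet.2 subset_canonicalDomain] with z hz hzD
    have : z - α ≠ 0 := sub_ne_zero.2 fun he => hαD (he ▸ hzD)
    rw [hz]
    simp only [eval_mul, eval_sub, eval_X, eval_C]
    field_simp

/-- Continuations to all `D_r` with `r < ρ` glue to a continuation to `D_ρ`. -/
theorem mem_clearingIdeal_of_forall_lt (hE : IsCompact E) (hne : E.Nonempty)
    (h : IsExteriorMap E (exteriorMap E)) {ρ : ℝ≥0∞} (hρ : 1 < ρ) {T : ℂ[X]}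
    (hT : ∀ r : ℝ, 1 < r → ENNReal.ofReal r < ρ → T ∈ clearingIdeal E F (ENNReal.ofReal r)) :
    T ∈ clearingIdeal E F ρ := by
  classical
  have hT' : ∀ r : ℝ, ∃ H, 1 < r → ENNReal.ofReal r < ρ →
      DifferentiableOn ℂ H (canonicalDomain E (ENNReal.ofReal r)) ∧
        H =ᶠ[𝓝ˢ E] fun z => T.eval z * F z := fun r => by
    by_cases hr : 1 < r ∧ ENNReal.ofReal r < ρ
    · obtain ⟨H, hH⟩ := hT r hr.1 hr.2
      exact ⟨H, fun _ _ => hH⟩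
    · exact ⟨0, fun h1 h2 => absurd ⟨h1, h2⟩ hr⟩
  choose H hH using hT'
  have hR : ∀ z, ∃ r : ℝ, z ∈ canonicalDomain E ρ → 1 < r ∧ ENNReal.ofReal r < ρ ∧
      z ∈ canonicalDomain E (ENNReal.ofReal r) := fun z => by
    by_cases hz : z ∈ canonicalDomain E ρ
    · obtain ⟨r, hr⟩ := exists_mem_canonicalDomain_ofReal h hρ hz
      exact ⟨r, fun _ => hr⟩
    · exact ⟨0, fun h1 => absurd h1 hz⟩
  choose R hR using hR
  have hagree : ∀ r s : ℝ, 1 < r → ENNReal.ofReal r < ρ → 1 < s → ENNReal.ofReal s < ρ →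
      ∀ z ∈ canonicalDomain E (ENNReal.ofReal r), z ∈ canonicalDomain E (ENNReal.ofReal s) →
        H r z = H s z := by
    intro r s hr hrρ hs hsρ z hzr hzs
    wlog hle : r ≤ s generalizing r s
    · exact (this s r hs hsρ hr hrρ hzs hzr (le_of_not_ge hle)).symm
    refine eqOn_of_eventuallyEq_nhdsSet hE hne h (one_lt_ofReal.2 hr) (hH r hr hrρ).1
      ((hH s hs hsρ).1.mono (canonicalDomain_mono (ENNReal.ofReal_le_ofReal hle))) ?_ hzr
    exact (hH r hr hrρ).2.trans (hH s hs hsρ).2.symm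
  have hglue : ∀ r : ℝ, 1 < r → ENNReal.ofReal r < ρ →
      EqOn (fun z => H (R z) z) (H r) (canonicalDomain E (ENNReal.ofReal r)) := by
    intro r hr hrρ z hz
    obtain ⟨h1, h2, h3⟩ := hR z (canonicalDomain_mono hrρ.le hz)
    exact hagree _ _ h1 h2 hr hrρ z h3 hz
  refine ⟨fun z => H (R z) z, fun z hz => ?_, ?_⟩
  · obtain ⟨h1, h2, h3⟩ := hR z hz
    have ho := isOpen_canonicalDomain hE h (one_lt_ofReal.2 h1)
    refine DifferentiableAt.differentiableWithinAt ?_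
    refine ((hH (R z) h1 h2).1.differentiableAt (ho.mem_nhds h3)).congr_of_eventuallyEq ?_
    filter_upwards [ho.mem_nhds h3] with y hy
    exact hglue _ h1 h2 hy
  · obtain ⟨q, -, hq1, hqρ⟩ := ENNReal.lt_iff_exists_real_btwn.1 hρ
    have hq := one_lt_ofReal.1 hq1
    exact (eventually_of_eqOn_canonicalDomain hE h (one_lt_ofReal.2 hq) (hglue q hq hqρ)).trans
      (hH q hq hqρ).2

/-! ### Counting poles -/

theorem poleOrder_eq_zero {G : ℂ → ℂ} {z : ℂ} (h0 : 0 ≤ meromorphicOrderAt G z) :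
    poleOrder G z = 0 := by
  have := WithTop.untop₀_nonneg.2 h0
  rw [poleOrder]
  omega

theorem poleCount_eq_zero {H : ℂ → ℂ} {D : Set ℂ} (hD : IsOpen D) (hH : DifferentiableOn ℂ H D) :
    poleCount H D = 0 := by
  rw [poleCount]
  simp only [ENat.iSup_eq_zero]
  intro S hS
  rw [Finset.sum_eq_zero fun z hz =>
    poleOrder_eq_zero (hH.analyticAt (hD.mem_nhds (hS hz))).meromorphicOrderAt_nonneg]
  rfl

theorem sum_poleOrder_le {G : ℂ → ℂ} {D : Set ℂ} {k : ℕ} (hG : poleCount G D ≤ k) {S : Finset ℂ}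
    (hS : (S : Set ℂ) ⊆ D) : ∑ z ∈ S, poleOrder G z ≤ k := by
  have h1 : ((∑ z ∈ S, poleOrder G z : ℕ) : ℕ∞) ≤ poleCount G D :=
    le_iSup₂_of_le (f := fun (S : Finset ℂ) (_ : (S : Set ℂ) ⊆ D) =>
      ((∑ z ∈ S, poleOrder G z : ℕ) : ℕ∞)) S hS le_rfl
  exact_mod_cast h1.trans hG

theorem finite_poles {G : ℂ → ℂ} {D : Set ℂ} {k : ℕ} (hG : poleCount G D ≤ k) :
    {z ∈ D | poleOrder G z ≠ 0}.Finite := by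
  by_contra hinf
  obtain ⟨S, hS, hcard⟩ := Set.Infinite.exists_subset_card_eq hinf (k + 1)
  have h1 := sum_poleOrder_le hG (S := S) fun z hz => (hS hz).1
  have h2 : S.card ≤ ∑ z ∈ S, poleOrder G z := by
    rw [Finset.card_eq_sum_ones]
    exact Finset.sum_le_sum fun z hz => Nat.one_le_iff_ne_zero.2 (hS hz).2
  omega

theorem neg_poleOrder_le (G : ℂ → ℂ) (z : ℂ) :
    ((-(poleOrder G z : ℤ) : ℤ) : WithTop ℤ) ≤ meromorphicOrderAt G z := by
  unfold poleOrder
  cases meromorphicOrderAt G z with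
  | top => exact le_top
  | coe a =>
    rw [WithTop.untop₀_coe]
    exact WithTop.coe_le_coe.2 (by omega)

/-- Multiplying by the polynomial with zeros at the poles makes a meromorphic continuation
holomorphic. -/
theorem exists_mem_clearingIdeal_of_extension (hE : IsCompact E)
    (h : IsExteriorMap E (exteriorMap E)) (hF : HolomorphicNear E F) {ρ : ℝ≥0∞} (hρ : 1 < ρ) {k : ℕ}
    {G : ℂ → ℂ} (hG : IsMeromorphicExtension E F (canonicalDomain E ρ) G)
    (hk : poleCount G (canonicalDomain E ρ) ≤ k) :
    ∃ T : ℂ[X], T ≠ 0 ∧ T.natDegree ≤ k ∧ T ∈ clearingIdeal E F ρ := by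
  classical
  set D := canonicalDomain E ρ
  have hD : IsOpen D := isOpen_canonicalDomain hE h hρ
  set S := (finite_poles hk).toFinset
  have hSD : (S : Set ℂ) ⊆ D := fun z hz => ((finite_poles hk).mem_toFinset.1 hz).1
  set T : ℂ[X] := ∏ a ∈ S, (X - C a) ^ poleOrder G a with hT
  have hmonic : T.Monic := monic_prod_of_monic _ _ fun a _ => (monic_X_sub_C a).pow _
  refine ⟨T, hmonic.ne_zero, ?_, ?_⟩
  · rw [hT, natDegree_prod_of_monic _ _ fun a _ => (monic_X_sub_C a).pow _]
    simpa using sum_poleOrder_le hk hSD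
  have hTan : ∀ z, AnalyticAt ℂ (fun z => T.eval z) z := fun z => T.differentiable.analyticAt z
  set f : ℂ → ℂ := (fun z => T.eval z) * G
  have hf : MeromorphicOn f D := fun z hz => (hTan z).meromorphicAt.mul (hG.1 z hz)
  have hTord : ∀ z ∈ D, ((poleOrder G z : ℤ) : WithTop ℤ) ≤
      meromorphicOrderAt (fun z => T.eval z) z := by
    intro z hz
    by_cases hzS : z ∈ S
    · have hsplit : (fun y => T.eval y) = (fun y => (y - z) ^ poleOrder G z) *
          fun y => (∏ a ∈ S.erase z, (X - C a) ^ poleOrder G a : ℂ[X]).eval y := by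
        ext y
        rw [hT, ← Finset.mul_prod_erase _ _ hzS]
        simp
      have h1 : AnalyticAt ℂ (fun y => (∏ a ∈ S.erase z, (X - C a) ^ poleOrder G a : ℂ[X]).eval
          y) z :=
        (Polynomial.differentiable _).analyticAt z
      have h2 : AnalyticAt ℂ (fun y : ℂ => (y - z) ^ poleOrder G z) z := by fun_prop
      rw [hsplit, meromorphicOrderAt_mul h2.meromorphicAt h1.meromorphicAt]
      have h3 : meromorphicOrderAt (fun y : ℂ => (y - z) ^ poleOrder G z) z = poleOrder G z := by
        simpa using fun_meromorphicOrderAt_pow_id_sub_const (𝕜 := ℂ) (x := z) (n := poleOrder G z)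
      rw [h3]
      exact le_add_of_nonneg_right h1.meromorphicOrderAt_nonneg
    · have h0 : poleOrder G z = 0 := by
        by_contra h0
        exact hzS ((finite_poles hk).mem_toFinset.2 ⟨hz, h0⟩)
      rw [h0]
      exact (hTan z).meromorphicOrderAt_nonneg
  have han : ∀ z ∈ D, AnalyticAt ℂ (toMeromorphicNFOn f D) z := by
    intro z hz
    refine (meromorphicNFOn_toMeromorphicNFOn f D hz).meromorphicOrderAt_nonneg_iff_analyticAt.1 ?_
    rw [meromorphicOrderAt_toMeromorphicNFOn hf hz,
      meromorphicOrderAt_mul (hTan z).meromorphicAt (hG.1 z hz)]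
    calc (0 : WithTop ℤ) = ((poleOrder G z : ℤ) : WithTop ℤ) +
        ((-(poleOrder G z : ℤ) : ℤ) : WithTop ℤ) := by
          rw [← WithTop.coe_add, add_neg_cancel]; rfl
      _ ≤ _ := add_le_add (hTord z hz) (neg_poleOrder_le G z)
  refine ⟨toMeromorphicNFOn f D, fun z hz => (han z hz).differentiableAt.differentiableWithinAt, ?_⟩
  refine eventually_nhdsSet_iff_forall.2 fun e he => ?_
  refine ((han e (Or.inl he)).continuousAt.eventuallyEq_nhds_iff_eventuallyEq_nhdsNE
    (T.continuous.continuousAt.mul (hF.analyticAt he).continuousAt)).1 ?_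
  filter_upwards [hf.toMeromorphicNFOn_eq_self_on_nhdsNE (Or.inl he),
    (eventually_nhdsSet_iff_forall.1 hG.2 e he).filter_mono nhdsWithin_le_nhds] with z h1 h2
  rw [h1]
  exact congrArg (T.eval z * ·) h2

theorem poleOrder_div {T : ℂ[X]} (hT : T ≠ 0) {H : ℂ → ℂ} {z : ℂ} (hH : AnalyticAt ℂ H z)
    (hz : T.IsRoot z → H z ≠ 0) : poleOrder (fun y => H y / T.eval y) z = T.rootMultiplicity z := by
  obtain ⟨q, hq, hqz⟩ := exists_eq_pow_rootMultiplicity_mul_and_not_dvd T hT z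
  set k := T.rootMultiplicity z with hk
  have hqz' : q.eval z ≠ 0 := fun h0 => hqz (dvd_iff_isRoot.2 h0)
  have hqan : AnalyticAt ℂ (fun y => q.eval y) z := q.differentiable.analyticAt z
  have hTan : AnalyticAt ℂ (fun y => T.eval y) z := T.differentiable.analyticAt z
  by_cases hroot : T.IsRoot z
  · have h1 : meromorphicOrderAt (fun y => H y / T.eval y) z = ((-(k : ℤ) : ℤ) : WithTop ℤ) := by
      refine (meromorphicOrderAt_eq_int_iff (hH.meromorphicAt.div hTan.meromorphicAt)).2
        ⟨fun y => H y / q.eval y, hH.div hqan hqz', div_ne_zero (hz hroot) hqz', ?_⟩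
      filter_upwards with y
      have : T.eval y = (y - z) ^ k * q.eval y := by
        conv_lhs => rw [hq]
        simp
      rw [Pi.div_apply, this, smul_eq_mul, zpow_neg, zpow_natCast, div_mul_eq_div_div_swap,
          div_eq_inv_mul _ ((y - z) ^ k)]
    rw [poleOrder, h1, WithTop.untop₀_coe]
    simp
  · rw [hk, rootMultiplicity_eq_zero hroot]
    exact poleOrder_eq_zero (hH.div hTan hroot).meromorphicOrderAt_nonneg

theorem poleCount_div {T : ℂ[X]} (hT : T ≠ 0) {H : ℂ → ℂ} {D : Set ℂ} (hD : IsOpen D)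
    (hH : DifferentiableOn ℂ H D) (hz : ∀ z, T.IsRoot z → z ∈ D ∧ H z ≠ 0) :
    poleCount (fun y => H y / T.eval y) D = T.natDegree := by
  classical
  have h1 : ∀ S : Finset ℂ, (S : Set ℂ) ⊆ D →
      ∑ z ∈ S, poleOrder (fun y => H y / T.eval y) z = ∑ z ∈ S, T.roots.count z := fun S hS =>
    Finset.sum_congr rfl fun z hzS => by
      rw [poleOrder_div hT (hH.analyticAt (hD.mem_nhds (hS hzS))) fun hr => (hz z hr).2,
          count_roots]
  have hcard : T.roots.card = T.natDegree := (splits_iff_card_roots.1 (IsAlgClosed.splits T))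
  refine le_antisymm ?_ ?_
  · refine iSup₂_le fun S hS => ?_
    rw [h1 S hS]
    have : ∑ z ∈ S, T.roots.count z ≤ T.natDegree := by
      rw [← hcard, ← Multiset.toFinset_sum_count_eq T.roots]
      refine Finset.sum_le_sum_of_ne_zero fun z _ hne => ?_
      exact Multiset.mem_toFinset.2 (Multiset.count_ne_zero.1 hne)
    exact_mod_cast this
  · refine le_iSup₂_of_le (f := fun (S : Finset ℂ) (_ : (S : Set ℂ) ⊆ D) =>
      ((∑ z ∈ S, poleOrder (fun y => H y / T.eval y) z : ℕ) : ℕ∞)) T.roots.toFinset ?_ ?_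
    · intro z hzr
      exact (hz z (isRoot_of_mem_roots (Multiset.mem_toFinset.1 hzr))).1
    · rw [h1, Multiset.toFinset_sum_count_eq, hcard]
      intro z hzr
      exact (hz z (isRoot_of_mem_roots (Multiset.mem_toFinset.1 hzr))).1

theorem le_rhoIndex_zero (hE : IsCompact E) (h : IsExteriorMap E (exteriorMap E)) {ρ : ℝ≥0∞}
    (hρ : 1 < ρ) {T : ℂ[X]} (hT : T ∈ clearingIdeal E F ρ) (k : ℕ) :
    ρ ≤ rhoIndex E k fun z => T.eval z * F z := by
  obtain ⟨H, hH, e⟩ := hT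
  have hD := isOpen_canonicalDomain hE h hρ
  refine le_sSup ⟨hρ, H, ⟨fun z hz => (hH.analyticAt (hD.mem_nhds hz)).meromorphicAt, e⟩, ?_⟩
  rw [poleCount_eq_zero hD hH]
  exact zero_le

theorem one_lt_rhoIndex (hE : IsCompact E) (h : IsExteriorMap E (exteriorMap E))
    (hF : HolomorphicNear E F) (k : ℕ) : 1 < rhoIndex E k F := by
  obtain ⟨r, hr, h1⟩ := hF.exists_one_mem hE h
  have := le_rhoIndex_zero hE h (one_lt_ofReal.2 hr) h1 k
  simp only [eval_one, one_mul] at this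
  exact (one_lt_ofReal.2 hr).trans_le this

/-- The supremum in the definition of `ρ_k(F)` is attained. The generators of the clearing ideals of
`D_r`, `r < ρ_k(F)`, have degree at most `k` and divide one another as `r` grows, so that they are
eventually constant. -/
theorem exists_mem_clearingIdeal_rhoIndex (hE : IsCompact E) (hne : E.Nonempty)
    (h : IsExteriorMap E (exteriorMap E)) (hF : HolomorphicNear E F) (k : ℕ) :
    ∃ T : ℂ[X], T ≠ 0 ∧ T.natDegree ≤ k ∧ T ∈ clearingIdeal E F (rhoIndex E k F) := by
  set R := rhoIndex E k F with hR
  have hR1 : 1 < R := one_lt_rhoIndex hE h hF k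
  let gen : ℝ → ℂ[X] := fun r => Submodule.IsPrincipal.generator (clearingIdeal E F
      (ENNReal.ofReal r))
  have hgen : ∀ r, gen r ∈ clearingIdeal E F (ENNReal.ofReal r) := fun r =>
    Submodule.IsPrincipal.generator_mem _
  have hdvd : ∀ r T, T ∈ clearingIdeal E F (ENNReal.ofReal r) → gen r ∣ T := fun r T hT =>
    (Submodule.IsPrincipal.mem_iff_generator_dvd _).1 hT
  have hdeg : ∀ r : ℝ, ENNReal.ofReal r < R → gen r ≠ 0 ∧ (gen r).natDegree ≤ k := by
    intro r hr
    obtain ⟨ρ', ⟨hρ', G, hG, hGk⟩, hlt⟩ := lt_sSup_iff.1 hr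
    obtain ⟨T, hT0, hTk, hT⟩ := exists_mem_clearingIdeal_of_extension hE h hF hρ' hG hGk
    have hd := hdvd r T (clearingIdeal_anti hlt.le hT)
    exact ⟨ne_zero_of_dvd_ne_zero hT0 hd, (natDegree_le_of_dvd hd hT0).trans hTk⟩
  -- a radius at which the degree of the generator is as large as possible
  obtain ⟨d, ⟨r₀, hr₀, hr₀R, rfl⟩, hmax⟩ : ∃ d : ℕ,
      (∃ r : ℝ, 1 < r ∧ ENNReal.ofReal r < R ∧ (gen r).natDegree = d) ∧
        ∀ r : ℝ, 1 < r → ENNReal.ofReal r < R → (gen r).natDegree ≤ d := by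
    classical
    obtain ⟨q, -, hq1, hqR⟩ := ENNReal.lt_iff_exists_real_btwn.1 hR1
    let P : ℕ → Prop := fun d => ∃ r : ℝ, 1 < r ∧ ENNReal.ofReal r < R ∧ (gen r).natDegree = d
    have hP : P (gen q).natDegree := ⟨q, one_lt_ofReal.1 hq1, hqR, rfl⟩
    refine ⟨Nat.findGreatest P k, Nat.findGreatest_spec (hdeg q hqR).2 hP, fun r hr hrR => ?_⟩
    exact Nat.le_findGreatest (hdeg r hrR).2 ⟨r, hr, hrR, rfl⟩
  refine ⟨gen r₀, (hdeg r₀ hr₀R).1, (hdeg r₀ hr₀R).2,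
    mem_clearingIdeal_of_forall_lt hE hne h hR1 fun r hr hrR => ?_⟩
  rcases le_total r r₀ with hle | hle
  · exact clearingIdeal_anti (ENNReal.ofReal_le_ofReal hle) (hgen r₀)
  · have h1 : gen r₀ ∣ gen r := hdvd r₀ _ (clearingIdeal_anti (ENNReal.ofReal_le_ofReal hle)
      (hgen r))
    have h2 : gen r ∣ gen r₀ := by
      obtain ⟨c, hc⟩ := h1
      have hr0 := (hdeg r hrR).1
      have hc0 : c ≠ 0 := by rintro rfl; exact hr0 (by rw [hc, mul_zero])
      have h3 : (gen r).natDegree = (gen r₀).natDegree + c.natDegree := by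
        rw [hc, natDegree_mul (hdeg r₀ hr₀R).1 hc0]
      have h4 := hmax r hr hrR
      have h5 : c.natDegree = 0 := by omega
      have hcu : IsUnit c := by
        rw [natDegree_eq_zero] at h5
        obtain ⟨x, rfl⟩ := h5
        exact isUnit_C.2 (isUnit_iff_ne_zero.2 fun h0 => hc0 (by rw [h0, C_0]))
      rw [hc]
      exact (hcu.dvd_mul_right).1 dvd_rfl
    exact Ideal.mem_of_dvd _ h2 (hgen r)

/-- A generator `T` of the clearing ideal of `D_ρ`, for `ρ = ρ_k(F)`. The continuation `H` of
`T F` does not vanish at the zeros of `T`, so that these are the poles of `F` in `D_ρ`. -/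
theorem exists_pole_polynomial (hE : IsCompact E) (hne : E.Nonempty)
    (h : IsExteriorMap E (exteriorMap E)) (hF : HolomorphicNear E F) (k : ℕ) :
    ∃ (T : ℂ[X]) (H : ℂ → ℂ), T ≠ 0 ∧ T.natDegree ≤ k ∧
      DifferentiableOn ℂ H (canonicalDomain E (rhoIndex E k F)) ∧
      (H =ᶠ[𝓝ˢ E] fun z => T.eval z * F z) ∧
      ∀ α, T.IsRoot α → α ∈ canonicalDomain E (rhoIndex E k F) ∧ H α ≠ 0 ∧ α ∉ E := by
  have hR1 : 1 < rhoIndex E k F := one_lt_rhoIndex hE h hF k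
  obtain ⟨T', hT'0, hT'k, hT'⟩ := exists_mem_clearingIdeal_rhoIndex hE hne h hF k
  set I := clearingIdeal E F (rhoIndex E k F)
  set T := Submodule.IsPrincipal.generator I
  have hTI : T ∈ I := Submodule.IsPrincipal.generator_mem _
  have hdvd : T ∣ T' := (Submodule.IsPrincipal.mem_iff_generator_dvd _).1 hT'
  have hT0 : T ≠ 0 := ne_zero_of_dvd_ne_zero hT'0 hdvd
  obtain ⟨H, hH, e⟩ := hTI
  refine ⟨T, H, hT0, (natDegree_le_of_dvd hdvd hT'0).trans hT'k, hH, e, fun α hα => ?_⟩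
  have key : ¬ (α ∈ canonicalDomain E (rhoIndex E k F) → H α = 0) := by
    intro hαH
    obtain ⟨S, hS⟩ := dvd_iff_isRoot.2 hα
    have hS0 : S ≠ 0 := by
      intro hS0
      exact hT0 (by rw [hS, hS0, mul_zero])
    have hSI : S ∈ I := by
      refine mem_clearingIdeal_of_mul hE h hF hR1 (α := α) hH ?_ hαH
      rw [← hS]
      exact e
    have h1 : T ∣ S := (Submodule.IsPrincipal.mem_iff_generator_dvd _).1 hSI
    have h2 := natDegree_le_of_dvd h1 hS0
    have h3 : T.natDegree = 1 + S.natDegree := by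
      rw [hS, natDegree_mul (X_sub_C_ne_zero α) hS0, natDegree_X_sub_C]
    omega
  rw [Classical.not_imp] at key
  refine ⟨key.1, key.2, fun hαE => key.2 ?_⟩
  have h1 := (eventually_nhdsSet_iff_forall.1 e α hαE).self_of_nhds
  rw [h1]
  simp only [hα.eq_zero, zero_mul]

theorem isMeromorphicExtension_div (hE : IsCompact E) (h : IsExteriorMap E (exteriorMap E))
    {ρ : ℝ≥0∞} (hρ : 1 < ρ) {T : ℂ[X]} {H : ℂ → ℂ}
    (hH : DifferentiableOn ℂ H (canonicalDomain E ρ)) (e : H =ᶠ[𝓝ˢ E] fun z => T.eval z * F z)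
    (hroot : ∀ α, T.IsRoot α → α ∉ E) :
    IsMeromorphicExtension E F (canonicalDomain E ρ) fun z => H z / T.eval z := by
  have hD := isOpen_canonicalDomain hE h hρ
  refine ⟨fun z hz => (hH.analyticAt (hD.mem_nhds hz)).meromorphicAt.div
    (T.differentiable.analyticAt z).meromorphicAt, ?_⟩
  have hopen : IsOpen {z | T.eval z ≠ 0} := isOpen_ne_fun T.continuous continuous_const
  filter_upwards [e, hopen.mem_nhdsSet.2 fun z hz h0 => hroot z h0 hz] with z hz hz0
  rw [hz, mul_div_cancel_left₀ _ hz0]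

end Ideal

/-! ### Incomplete Padé denominators -/

section Pade

variable {E : Set ℂ} {μ : Measure ℂ} {F : ℂ → ℂ} {m m' : ℕ}

/-- The numerators are orthogonal to `p_n` by their degree, so that they drop out of the relation of
index `n`. -/
theorem fourierCoef_denominator_eq_zero (hE : IsCompact E) (hμ : IsMeasureOn E μ)
    (hF : HolomorphicNear E F) {n : ℕ} {Q : ℂ[X]} (hQ : IsIncompletePadeDenominator μ F n m m' Q)
    {T : ℂ[X]} (hT : T.natDegree < m') {H : ℂ → ℂ} (hH : EqOn H (fun z => T.eval z * F z) E) :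
    fourierCoef μ (fun z => Q.eval z * H z) n = 0 := by
  have hQF : ContinuousOn (fun z => Q.eval z * F z) E := Q.continuous.continuousOn.mul
      hF.continuousOn
  have h1 : fourierCoef μ (fun z => Q.eval z * H z) n =
      fourierCoef μ (fun z => T.eval z * (Q.eval z * F z)) n :=
    fourierCoef_congr hμ (fun z hz => by simp only [hH hz]; ring) n
  rw [h1, fourierCoef_eval_mul hE hμ hQF le_rfl]
  refine Finset.sum_eq_zero fun k hk => ?_
  obtain ⟨P, hP⟩ := hQ.2.2
  obtain ⟨hPdeg, hPort⟩ := hP k (by have := Finset.mem_range.1 hk; omega)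
  have h2 : fourierCoef μ (fun z => Q.eval z * z ^ k * F z - (P k).eval z) n = 0 := hPort n le_rfl
  rw [fourierCoef_sub hE hμ (f := fun z => Q.eval z * z ^ k * F z) (g := fun z => (P k).eval z)
    ((Q.continuous.continuousOn.mul (continuousOn_id.pow k)).mul hF.continuousOn)
    (P k).continuous.continuousOn, fourierCoef_eq_zero_of_degree_lt hE hμ hPdeg, sub_zero] at h2
  have h3 : fourierCoef μ (fun z => z ^ k * (Q.eval z * F z)) n =
      fourierCoef μ (fun z => Q.eval z * z ^ k * F z) n :=
    fourierCoef_congr hμ (fun z _ => by ring) n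
  rw [h3, h2, mul_zero]

theorem norm_coeff_le_coeffNorm (P : ℂ[X]) (i : ℕ) : ‖P.coeff i‖ ≤ coeffNorm P := by
  by_cases hi : i ∈ P.support
  · exact Finset.single_le_sum (f := fun i => ‖P.coeff i‖) (fun _ _ => norm_nonneg _) hi
  · rw [notMem_support_iff.1 hi, norm_zero]
    exact Finset.sum_nonneg fun _ _ => norm_nonneg _

theorem exists_geometric_bound {Q : ℕ → ℂ[X]} {Qm : ℂ[X]}
    (hconv : limsup (fun n : ℕ => ENNReal.ofReal (coeffNorm (Q n - Qm)) ^ (1 / (n : ℝ))) atTop < 1) :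
    ∃ θ : ℝ, 0 < θ ∧ θ < 1 ∧ ∀ᶠ n in atTop, ∀ i, ‖(Q n - Qm).coeff i‖ ≤ θ ^ n := by
  obtain ⟨θ, hθ0, hlt, hθ1⟩ := ENNReal.lt_iff_exists_real_btwn.1 hconv
  have hθ : 0 < θ := ENNReal.ofReal_pos.1 (bot_le.trans_lt hlt)
  refine ⟨θ, hθ, by simpa using hθ1, ?_⟩
  filter_upwards [eventually_lt_of_limsup_lt hlt, eventually_ge_atTop 1] with n hn hn1 i
  have h0 : 0 ≤ coeffNorm (Q n - Qm) := Finset.sum_nonneg fun _ _ => norm_nonneg _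
  rw [ENNReal.ofReal_rpow_of_nonneg h0 (by positivity), ENNReal.ofReal_lt_ofReal_iff hθ] at hn
  exact (norm_coeff_le_coeffNorm _ i).trans (rpow_one_div_le h0 (by omega) hn.le)

variable {Q : ℕ → ℂ[X]} {Qm : ℂ[X]} {θ : ℝ}

/-- Overconvergence: the coefficient `⟨Q_m T F, p_n⟩ = ⟨(Q_m - Q_n) T F, p_n⟩` decays faster than
those of `T F` by the factor `θ ^ n`, so that `Q_m T F` continues beyond the domain of `T F`. -/
theorem exists_mul_mem_clearingIdeal (hE : IsCompact E) (hμ : IsReg12 E μ)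
    (hF : HolomorphicNear E F) (hQ : ∀ n, 1 ≤ n → IsIncompletePadeDenominator μ F n m m' (Q n))
    (hQm : Qm.natDegree ≤ m) (hθ0 : 0 < θ) (hθ1 : θ < 1)
    (hθ : ∀ᶠ n in atTop, ∀ i, ‖(Q n - Qm).coeff i‖ ≤ θ ^ n)
    {T : ℂ[X]} (hT : T.natDegree < m') {r : ℝ} (hr : 1 < r)
    (hTI : T ∈ clearingIdeal E F (ENNReal.ofReal r)) :
    ∃ r', r < r' ∧ Qm * T ∈ clearingIdeal E F (ENNReal.ofReal r') := by
  have h := hμ.isExteriorMap hE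
  have hM := hμ.isMeasureOn
  have hρ := one_lt_ofReal.2 hr
  have hr0 : 0 < r := one_pos.trans hr
  obtain ⟨H, hH, e⟩ := hTI
  have hHE : EqOn H (fun z => T.eval z * F z) E := fun z hz =>
    (eventually_nhdsSet_iff_forall.1 e z hz).self_of_nhds
  have hHc : ContinuousOn H E := hH.continuousOn.mono subset_canonicalDomain
  -- any decay rate `q > 1 / r` is available for `H`; it is taken so small that `θ q < 1 / r`
  obtain ⟨q, hqr, hqθ⟩ : ∃ q, r⁻¹ < q ∧ q < r⁻¹ / θ :=
    exists_between (by rw [lt_div_iff₀ hθ0]; exact mul_lt_of_lt_one_right (inv_pos.2 hr0) hθ1)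
  have hq0 : 0 < q := (inv_pos.2 hr0).trans hqr
  have hθq : θ * q < r⁻¹ := by rw [lt_div_iff₀ hθ0] at hqθ; linarith
  obtain ⟨r', hrr', hr'⟩ : ∃ r', r < r' ∧ θ * q * r' < 1 := by
    have h0 : 0 < θ * q := mul_pos hθ0 hq0
    obtain ⟨s, h1, h2⟩ := exists_between (show r < (θ * q)⁻¹ from (lt_inv_comm₀ h0 hr0).1 hθq)
    rw [← one_div, lt_div_iff₀' h0] at h2
    exact ⟨s, h1, h2⟩
  have hbd : ∀ i : ℕ, ∃ C, 0 < C ∧ ∀ n, ‖fourierCoef μ (fun z => z ^ i * H z) n‖ ≤ C * q ^ n :=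
      fun i =>
    exists_norm_fourierCoef_le hE hμ hρ ((differentiable_id.pow i).differentiableOn.mul hH) hq0
      ((ENNReal.ofReal_lt_ofReal_iff hr0).2 (inv_lt_of_inv_lt₀ hr0 hqr))
  choose C hC hb using hbd
  have hev : ∀ᶠ n in atTop, ‖fourierCoef μ (fun z => Qm.eval z * H z) n‖ ≤
      (∑ i ∈ Finset.range (m + 1), C i) * (θ * q) ^ n := by
    filter_upwards [hθ, eventually_ge_atTop 1] with n hn hn1
    have h1 := fourierCoef_denominator_eq_zero hE hM hF (hQ n hn1) hT hHE
    have h2 : fourierCoef μ (fun z => (Q n - Qm).eval z * H z) n =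
        - fourierCoef μ (fun z => Qm.eval z * H z) n := by
      rw [← zero_sub, ← h1, ← fourierCoef_sub hE hM
        (f := fun z => (Q n).eval z * H z) (g := fun z => Qm.eval z * H z)
        ((Q n).continuous.continuousOn.mul hHc) (Qm.continuous.continuousOn.mul hHc)]
      exact fourierCoef_congr hM (fun z _ => by simp only [eval_sub]; ring) n
    rw [← norm_neg, ← h2, fourierCoef_eval_mul hE hM hHc
      ((natDegree_sub_le _ _).trans (max_le (hQ n hn1).2.1 hQm)), Finset.sum_mul]
    refine norm_sum_le_of_le _ fun i _ => ?_
    rw [norm_mul, mul_pow]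
    calc _ ≤ θ ^ n * (C i * q ^ n) :=
          mul_le_mul (hn i) (hb i n) (norm_nonneg _) (pow_pos hθ0 n).le
      _ = _ := by ring
  obtain ⟨C', -, hC'⟩ := exists_bound_of_eventually
    (f := fun n => ‖fourierCoef μ (fun z => Qm.eval z * H z) n‖) (mul_pos hθ0 hq0) (by
    filter_upwards [hev] with n hn
    rwa [norm_norm])
  have hQH : DifferentiableOn ℂ (fun z => Qm.eval z * H z) (canonicalDomain E (ENNReal.ofReal r)) :=
    Qm.differentiable.differentiableOn.mul hH
  refine ⟨r', hrr', _, differentiableOn_orthogonalSeries hE hμ (mul_pos hθ0 hq0) hC'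
    (hr.trans hrr') hr', ?_⟩
  have h3 := eqOn_fourierSeries hE hμ hρ hQH (mul_pos hθ0 hq0) hC' (hr.trans hrr') hr'
  filter_upwards [eventually_of_eqOn_canonicalDomain hE h
    (lt_min hρ (one_lt_ofReal.2 (hr.trans hrr'))) h3, e] with z h4 h5
  rw [h4, h5, eval_mul, mul_assoc]

/-- The limit polynomial vanishes at the poles of `F` to their full order. If it vanishes at a
pole `α` only to a smaller order `ν`, let `T₁ = T / (X - α) ^ (ν + 1)`. Then `T₁ F` is holomorphic
up to the level curve through `α`, so that `Q_m T₁ F` continues holomorphically beyond this curve;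
yet it has a simple pole at `α`. -/
theorem pole_polynomial_dvd (hE : IsCompact E) (hne : E.Nonempty) (hμ : IsReg12 E μ)
    (hF : HolomorphicNear E F) (hQ : ∀ n, 1 ≤ n → IsIncompletePadeDenominator μ F n m m' (Q n))
    (hQm : Qm.natDegree ≤ m) (hQm0 : Qm ≠ 0) (hθ0 : 0 < θ) (hθ1 : θ < 1)
    (hθ : ∀ᶠ n in atTop, ∀ i, ‖(Q n - Qm).coeff i‖ ≤ θ ^ n)
    {ρ : ℝ≥0∞} {T : ℂ[X]} {H : ℂ → ℂ} (hT0 : T ≠ 0) (hT : T.natDegree < m')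
    (hH : DifferentiableOn ℂ H (canonicalDomain E ρ)) (e : H =ᶠ[𝓝ˢ E] fun z => T.eval z * F z)
    (hroot : ∀ α, T.IsRoot α → α ∈ canonicalDomain E ρ ∧ H α ≠ 0 ∧ α ∉ E) : T ∣ Qm := by
  classical
  have h := hμ.isExteriorMap hE
  rw [IsAlgClosed.dvd_iff_roots_le_roots hT0 hQm0, Multiset.le_iff_count]
  intro α
  rw [count_roots, count_roots]
  by_contra! hlt
  obtain ⟨T₁, hT₁⟩ := (le_rootMultiplicity_iff hT0).1 (Nat.succ_le_of_lt hlt)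
  obtain ⟨q, hq, hqα⟩ := exists_eq_pow_rootMultiplicity_mul_and_not_dvd Qm hQm0 α
  set ν := Qm.rootMultiplicity α
  have hα : T.IsRoot α := (rootMultiplicity_pos hT0).1 (by omega)
  obtain ⟨hαD, hHα, hαE⟩ := hroot α hα
  set r := ‖exteriorMap E α‖ with hrdef
  have hr : 1 < r := h.one_lt_norm hαE
  have hrρ : ENNReal.ofReal r < ρ := (mem_canonicalDomain_iff hαE).1 hαD
  have hαr : α ∉ canonicalDomain E (ENNReal.ofReal r) := fun h' =>
    lt_irrefl _ ((mem_canonicalDomain_ofReal hαE).1 h')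
  have hT₁deg : T₁.natDegree < m' := (natDegree_le_of_dvd ⟨_, by rw [mul_comm]; exact hT₁⟩
      hT0).trans_lt hT
  have hTe : ∀ z, T.eval z = (z - α) ^ (ν + 1) * T₁.eval z := fun z => by
    conv_lhs => rw [hT₁]
    simp
  have hQe : ∀ z, Qm.eval z = (z - α) ^ ν * q.eval z := fun z => by
    conv_lhs => rw [hq]
    simp
  have hT₁I : T₁ ∈ clearingIdeal E F (ENNReal.ofReal r) := by
    refine ⟨fun z => H z / (z - α) ^ (ν + 1), (hH.mono (canonicalDomain_mono hrρ.le)).div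
      ((differentiableOn_id.sub_const α).pow _) fun z hz =>
        pow_ne_zero _ (sub_ne_zero.2 fun he => hαr (he ▸ hz)), ?_⟩
    filter_upwards [e, (isOpen_canonicalDomain hE h (one_lt_ofReal.2 hr)).mem_nhdsSet.2
      subset_canonicalDomain] with z hz hzD
    have : z - α ≠ 0 := sub_ne_zero.2 fun he => hαr (he ▸ hzD)
    rw [hz, hTe]
    field_simp
  obtain ⟨r', hrr', hr'⟩ := exists_mul_mem_clearingIdeal hE hμ hF hQ hQm hθ0 hθ1 hθ hT₁deg hr hT₁I
  have hlt' : ENNReal.ofReal r < min (ENNReal.ofReal r') ρ :=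
    lt_min ((ENNReal.ofReal_lt_ofReal_iff ((one_pos.trans hr).trans hrr')).2 hrr') hrρ
  obtain ⟨K, hK, eK⟩ := clearingIdeal_anti (min_le_left _ ρ) hr'
  have hα'' : α ∈ canonicalDomain E (min (ENNReal.ofReal r') ρ) :=
    (mem_canonicalDomain_iff hαE).2 hlt'
  have heq := eqOn_of_eventuallyEq_nhdsSet hE hne h ((one_lt_ofReal.2 hr).trans hlt')
    (f := fun z => (z - α) * K z) (g := fun z => q.eval z * H z)
    ((differentiableOn_id.sub_const α).mul hK)
    (q.differentiable.differentiableOn.mul (hH.mono (canonicalDomain_mono (min_le_right _ _)))) (by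
      filter_upwards [eK, e] with z h1 h2
      rw [h1, h2, eval_mul, hTe, hQe]
      ring) hα''
  simp only [sub_self, zero_mul] at heq
  exact (mul_ne_zero (fun h0 => hqα (dvd_iff_isRoot.2 h0)) hHα) heq.symm

/-- If `S F` is holomorphic on `D_ρ` and becomes holomorphic on the larger `D_ρ'` on multiplication by
a polynomial with zeros in `D_ρ`, then it is itself holomorphic on `D_ρ'`: at these zeros, the only
candidates for poles, it is already known to be holomorphic. -/
theorem mem_clearingIdeal_of_mul_prod (hE : IsCompact E) (hne : E.Nonempty)
    (h : IsExteriorMap E (exteriorMap E)) (hF : HolomorphicNear E F) {ρ ρ' : ℝ≥0∞} (hρ : 1 < ρ)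
    (hle : ρ ≤ ρ') {S : ℂ[X]} (hS : S ∈ clearingIdeal E F ρ) (s : Multiset ℂ) :
    (∀ α ∈ s, α ∈ canonicalDomain E ρ) →
      S * (s.map fun a => X - C a).prod ∈ clearingIdeal E F ρ' → S ∈ clearingIdeal E F ρ' := by
  induction s using Multiset.induction_on with
  | empty => intro _ h1; simpa using h1
  | cons a s ih =>
    intro hs h1
    refine ih (fun α hα => hs α (Multiset.mem_cons_of_mem hα)) ?_
    rw [Multiset.map_cons, Multiset.prod_cons, mul_left_comm] at h1
    obtain ⟨H, hH, e⟩ := h1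
    obtain ⟨K, hK, eK⟩ := Ideal.mul_mem_right (s.map fun a => X - C a).prod _ hS
    refine mem_clearingIdeal_of_mul hE h hF (hρ.trans_le hle) hH e fun _ => ?_
    have h2 := eqOn_of_eventuallyEq_nhdsSet hE hne h hρ (hH.mono (canonicalDomain_mono hle))
      (g := fun z => (z - a) * K z) ((differentiableOn_id.sub_const a).mul hK) (by
        filter_upwards [e, eK] with z h3 h4
        rw [h3, h4, eval_mul]
        simp only [eval_sub, eval_X, eval_C]
        ring) (hs a (Multiset.mem_cons_self a s))
    simpa using h2

/-! ### The entire case -/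

/-- A sequence decaying faster than every geometric sequence, and dominated by its tails, is
eventually zero. -/
theorem exists_forall_eq_zero_of_le_tail {a : ℕ → ℝ} (ha0 : ∀ n, 0 ≤ a n)
    (ha : ∀ q : ℝ, 0 < q → ∃ C, 0 < C ∧ ∀ n, a n ≤ C * q ^ n) {B : ℝ} (hB : 0 ≤ B)
    (htail : ∀ᶠ j in atTop, a j ≤ B * ∑' i, a (i + (j + 1))) : ∃ J, ∀ j, J ≤ j → a j = 0 := by
  have hsum : Summable a := by
    obtain ⟨C, -, hC⟩ := ha (1 / 2) (by norm_num)
    exact Summable.of_nonneg_of_le ha0 hC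
      ((summable_geometric_of_lt_one (by norm_num) (by norm_num)).mul_left C)
  have hsumN : ∀ N, Summable fun i => a (i + N) := fun N => (summable_nat_add_iff N).2 hsum
  set τ : ℕ → ℝ := fun N => ∑' i, a (i + N)
  obtain ⟨J, hJ⟩ := eventually_atTop.1 htail
  set b := 1 + B
  have hb : 0 < b := by positivity
  have hstep : ∀ j, J ≤ j → τ j ≤ b * τ (j + 1) := by
    intro j hj
    have h1 : τ j = a j + τ (j + 1) := by
      simp only [τ]
      rw [(hsumN j).tsum_eq_zero_add]
      simp only [zero_add]
      congr 2
      ext i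
      congr 1
      omega
    have := hJ j hj
    rw [h1]
    simp only [b, τ] at *
    linarith
  have hiter : ∀ i, τ J ≤ b ^ i * τ (J + i) := by
    intro i
    induction i with
    | zero => simp
    | succ i ih =>
      refine ih.trans ?_
      rw [pow_succ, mul_assoc]
      exact mul_le_mul_of_nonneg_left (hstep (J + i) (by omega)) (pow_pos hb i).le
  -- the ratio `q = 1 / (2 b)` beats the growth factor `b` of the tails
  set q := 1 / (2 * b)
  have hq : 0 < q := by positivity
  have hq1 : q < 1 := by
    simp only [q]
    rw [div_lt_one (by positivity)]
    simp only [b]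
    linarith
  obtain ⟨C, hC0, hC⟩ := ha q hq
  have hτ : ∀ N, τ N ≤ C * (1 - q)⁻¹ * q ^ N := by
    intro N
    have hg := (summable_geometric_of_lt_one hq.le hq1).mul_left (C * q ^ N)
    calc τ N ≤ ∑' i, C * q ^ N * q ^ i := (hsumN N).tsum_le_tsum (fun i => by
            refine (hC (i + N)).trans (le_of_eq ?_)
            rw [pow_add]; ring) hg
      _ = C * (1 - q)⁻¹ * q ^ N := by
            rw [tsum_mul_left, tsum_geometric_of_lt_one hq.le hq1]; ring
  have hτJ : τ J ≤ 0 := by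
    have hlim : Tendsto (fun i : ℕ => C * (1 - q)⁻¹ * q ^ J * (1 / 2 : ℝ) ^ i) atTop (𝓝 0) := by
      simpa using (tendsto_pow_atTop_nhds_zero_of_lt_one (r := (1 / 2 : ℝ)) (by norm_num)
        (by norm_num)).const_mul (C * (1 - q)⁻¹ * q ^ J)
    refine ge_of_tendsto' hlim fun i => (hiter i).trans ?_
    calc b ^ i * τ (J + i) ≤ b ^ i * (C * (1 - q)⁻¹ * q ^ (J + i)) :=
          mul_le_mul_of_nonneg_left (hτ _) (pow_pos hb i).le
      _ = C * (1 - q)⁻¹ * q ^ J * (b * q) ^ i := by rw [pow_add, mul_pow]; ring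
      _ = _ := by
          congr 2
          simp only [q]
          field_simp
  refine ⟨J, fun j hj => le_antisymm ?_ (ha0 j)⟩
  have h1 := (hsumN J).le_tsum (j - J) fun i _ => ha0 _
  rw [Nat.sub_add_cancel hj] at h1
  exact h1.trans hτJ

theorem norm_fourierCoef_mul_orthoPoly_le (hE : IsCompact E) (hμ : IsMeasureOn E μ) {f : ℂ → ℂ}
    {M : ℝ} (hM : ∀ z ∈ E, ‖f z‖ ≤ M) (k n : ℕ) :
    ‖fourierCoef μ (fun z => f z * (orthoPoly μ k).eval z) n‖ ≤ M := by
  have hnorm : ∀ k, Integrable (fun z => ‖(orthoPoly μ k).eval z‖ ^ 2) μ ∧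
      ∫ z, ‖(orthoPoly μ k).eval z‖ ^ 2 ∂μ = 1 := by
    intro k
    have h4 : ∀ z, (orthoPoly μ k).eval z * conj ((orthoPoly μ k).eval z) =
        ((‖(orthoPoly μ k).eval z‖ ^ 2 : ℝ) : ℂ) := fun z => by
      rw [Complex.mul_conj, Complex.normSq_eq_norm_sq]
    have h1 := fourierCoef_orthoPoly hE hμ k k
    rw [if_pos rfl, fourierCoef, ip] at h1
    simp only [h4] at h1
    rw [show (∫ z, ((‖(orthoPoly μ k).eval z‖ ^ 2 : ℝ) : ℂ) ∂μ) =
      ((∫ z, ‖(orthoPoly μ k).eval z‖ ^ 2 ∂μ : ℝ) : ℂ) from integral_ofReal] at h1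
    refine ⟨?_, by exact_mod_cast h1⟩
    have : Integrable (fun z => ((‖(orthoPoly μ k).eval z‖ ^ 2 : ℝ) : ℂ)) μ :=
      hμ.integrable hE (Complex.continuous_ofReal.comp_continuousOn
        ((orthoPoly μ k).continuous.continuousOn.norm.pow 2))
    simpa only [RCLike.re_to_complex, Complex.ofReal_re] using this.re
  have hbd := norm_integral_le_of_norm_le (μ := μ)
    (f := fun z => f z * (orthoPoly μ k).eval z * conj ((orthoPoly μ n).eval z))
    (g := fun z => M / 2 * (‖(orthoPoly μ k).eval z‖ ^ 2 + ‖(orthoPoly μ n).eval z‖ ^ 2))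
    (((hnorm k).1.add (hnorm n).1).const_mul _) (by
      filter_upwards [hμ.ae_mem] with z hz
      rw [norm_mul, norm_mul, RCLike.norm_conj, mul_assoc]
      have h1 := hM z hz
      have h0 : 0 ≤ M := (norm_nonneg _).trans h1
      have h2 : ‖(orthoPoly μ k).eval z‖ * ‖(orthoPoly μ n).eval z‖ ≤
          (‖(orthoPoly μ k).eval z‖ ^ 2 + ‖(orthoPoly μ n).eval z‖ ^ 2) / 2 := by
        linarith [two_mul_le_add_sq ‖(orthoPoly μ k).eval z‖ ‖(orthoPoly μ n).eval z‖]
      calc _ ≤ M * ((‖(orthoPoly μ k).eval z‖ ^ 2 + ‖(orthoPoly μ n).eval z‖ ^ 2) / 2) :=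
            mul_le_mul h1 h2 (by positivity) h0
        _ = _ := by ring)
  rw [integral_const_mul, integral_add (hnorm k).1 (hnorm n).1, (hnorm k).2, (hnorm n).2] at hbd
  refine hbd.trans (le_of_eq ?_)
  ring

/-- If `T F` is entire, with `deg T < m'`, then it is a polynomial. The relations
`⟨Q_n T F, p_n⟩ = 0` express the coefficient `⟨T F, p_{n-m}⟩` by the later ones, with factors that
stay bounded because `κ_{n-m} / κ_n` stays away from zero; the coefficients of an entire function
decay too fast for that unless they eventually vanish. -/
theorem exists_eq_polynomial_of_entire (hE : IsCompact E) (hμ : IsReg12m E m μ)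
    (hF : HolomorphicNear E F) (hQ : ∀ n, 1 ≤ n → IsIncompletePadeDenominator μ F n m m' (Q n))
    (hm : 1 ≤ m) (hQm : Qm.natDegree = m) (hθ0 : 0 < θ) (hθ1 : θ < 1)
    (hθ : ∀ᶠ n in atTop, ∀ i, ‖(Q n - Qm).coeff i‖ ≤ θ ^ n)
    {T : ℂ[X]} {H : ℂ → ℂ} (hT : T.natDegree < m')
    (hH : DifferentiableOn ℂ H (canonicalDomain E ⊤)) (e : H =ᶠ[𝓝ˢ E] fun z => T.eval z * F z) :
    ∃ P : ℂ[X], ∀ᶠ z in 𝓝ˢ E, T.eval z * F z = P.eval z := by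
  have hμ' := hμ.isReg12
  have hMs := hμ'.isMeasureOn
  have h := hμ'.isExteriorMap hE
  have hHE : EqOn H (fun z => T.eval z * F z) E := fun z hz =>
    (eventually_nhdsSet_iff_forall.1 e z hz).self_of_nhds
  set a : ℕ → ℂ := fourierCoef μ H
  -- `q` is arbitrary because `H` is entire
  have hdecay : ∀ q : ℝ, 0 < q → ∃ C, 0 < C ∧ ∀ n, ‖a n‖ ≤ C * q ^ n := fun q hq =>
    exists_norm_fourierCoef_le hE hμ' ENNReal.one_lt_top hH hq ENNReal.ofReal_lt_top
  have hasum : Summable fun n => ‖a n‖ := by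
    obtain ⟨C, -, hC⟩ := hdecay (1 / 2) (by norm_num)
    exact Summable.of_nonneg_of_le (fun _ => norm_nonneg _) hC
      ((summable_geometric_of_lt_one (by norm_num) (by norm_num)).mul_left C)
  -- the relation `⟨Q_n H, p_n⟩ = 0`, expanded along the Fourier series of `H`
  have hser : ∀ n, 1 ≤ n →
      HasSum (fun k => a k * fourierCoef μ (fun z => (Q n).eval z *
          (orthoPoly μ k).eval z) n) 0 := by
    intro n hn
    obtain ⟨C, -, hC⟩ := hdecay (1 / 4) (by norm_num)
    have h1 := hasSum_integral_orthogonalSeries hE hμ' (r := 2) (by norm_num) hC (by norm_num)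
      (by norm_num) (φ := fun z => (Q n).eval z * conj ((orthoPoly μ n).eval z))
      ((Q n).continuous.continuousOn.mul (continuousOn_conj_eval _))
    have h2 := eqOn_fourierSeries hE hμ' ENNReal.one_lt_top hH (r := 2) (by norm_num) hC
      (by norm_num) (by norm_num)
    have h3 : ∫ z, (∑' k, a k * (orthoPoly μ k).eval z) *
        ((Q n).eval z * conj ((orthoPoly μ n).eval z)) ∂μ = 0 := by
      rw [← fourierCoef_denominator_eq_zero hE hMs hF (hQ n hn) hT hHE]
      refine integral_congr_ae ?_
      filter_upwards [hMs.ae_mem] with z hz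
      have h4 : ∑' k, a k * (orthoPoly μ k).eval z = H z := h2 (Or.inl hz)
      rw [h4]
      ring
    rw [h3] at h1
    convert h1 using 3 with k
    refine integral_congr_ae (Eventually.of_forall fun z => ?_)
    simp only
    ring
  -- a bound for the denominators on `E`
  obtain ⟨M, hM0, hM⟩ : ∃ M, 0 ≤ M ∧ ∀ᶠ n in atTop, ∀ z ∈ E, ‖(Q n).eval z‖ ≤ M := by
    obtain ⟨B, hB⟩ := hE.isBounded.exists_norm_le
    obtain ⟨B', hB'⟩ := hE.exists_bound_of_continuousOn Qm.continuous.continuousOn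
    refine ⟨|B'| + ∑ i ∈ Finset.range (m + 1), |B| ^ i, by positivity, ?_⟩
    filter_upwards [hθ, eventually_ge_atTop 1] with n hn hn1 z hz
    have h1 : (Q n).eval z = Qm.eval z + (Q n - Qm).eval z := by simp
    rw [h1]
    refine (norm_add_le _ _).trans (add_le_add ((hB' z hz).trans (le_abs_self _)) ?_)
    rw [eval_eq_sum_range'
      (Nat.lt_succ_of_le ((natDegree_sub_le _ _).trans (max_le (hQ n hn1).2.1 hQm.le)))]
    refine norm_sum_le_of_le _ fun i _ => ?_
    rw [norm_mul, norm_pow]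
    calc ‖(Q n - Qm).coeff i‖ * ‖z‖ ^ i ≤ 1 * |B| ^ i := by
          gcongr
          · exact (hn i).trans (pow_le_one₀ hθ0.le hθ1.le)
          · exact (hB z hz).trans (le_abs_self _)
      _ = _ := one_mul _
  have hdeg : ∀ᶠ n in atTop, (Q n).natDegree = m ∧ (Q n).coeff m = 1 := by
    have hlc : 0 < ‖Qm.coeff m‖ := by
      rw [norm_pos_iff, ← hQm]
      refine leadingCoeff_ne_zero.2 fun h0 => ?_
      rw [h0, natDegree_zero] at hQm
      omega
    filter_upwards [hθ, (tendsto_pow_atTop_nhds_zero_of_lt_one hθ0.le hθ1).eventually_lt_const hlc,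
      eventually_ge_atTop 1] with n hn hn2 hn1
    have h0 : (Q n).coeff m ≠ 0 := by
      intro h0
      have := hn m
      rw [coeff_sub, h0, zero_sub, norm_neg] at this
      linarith
    have h1 : (Q n).natDegree = m := le_antisymm (hQ n hn1).2.1 (le_natDegree_of_ne_zero h0)
    refine ⟨h1, ?_⟩
    have := (hQ n hn1).1.coeff_natDegree
    rwa [h1] at this
  obtain ⟨c, hc, n₀, hratio⟩ := hμ.ratio
  -- in the relation of index `n = j + m` the terms with `k < j` vanish, as `Q_n p_k` has degree
  -- less
  -- than `n`, and the one with `k = j` is `a j * κ_j / κ_n`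
  have htail : ∀ᶠ j in atTop, ‖a j‖ ≤ M / c * ∑' i, ‖a (i + (j + 1))‖ := by
    filter_upwards [(tendsto_add_atTop_nat m).eventually hM, (tendsto_add_atTop_nat
        m).eventually hdeg,
      eventually_ge_atTop n₀] with j hMj ⟨hdj, hmj⟩ hj
    have hs := hser (j + m) (by omega)
    have hzero : ∀ k, k < j →
        fourierCoef μ (fun z => (Q (j + m)).eval z * (orthoPoly μ k).eval z) (j + m) = 0 := by
      intro k hk
      have := fourierCoef_eq_zero_of_degree_lt hE hMs (P := Q (j + m) * orthoPoly μ k) (n :=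
          j + m) (by
        refine degree_le_natDegree.trans_lt ?_
        have h1 := natDegree_mul_le (p := Q (j + m)) (q := orthoPoly μ k)
        rw [hdj, (orthoPoly_spec hE hMs).natDegree_eq k] at h1
        exact_mod_cast (by omega : (Q (j + m) * orthoPoly μ k).natDegree < j + m))
      simpa only [eval_mul] using this
    have hone : fourierCoef μ (fun z => (Q (j + m)).eval z * (orthoPoly μ j).eval z) (j + m) =
        kappa μ j / kappa μ (j + m) := by
      have hdeg' := (orthoPoly_spec hE hMs).natDegree_eq j
      have h2 := fourierCoef_of_degree_lt_succ hE hMs (P := Q (j + m) * orthoPoly μ j) (n :=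
          j + m) (by
        refine degree_le_natDegree.trans_lt ?_
        have h1 := natDegree_mul_le (p := Q (j + m)) (q := orthoPoly μ j)
        rw [hdj, hdeg'] at h1
        exact_mod_cast (by omega : (Q (j + m) * orthoPoly μ j).natDegree < j + m + 1))
      have h3 : (Q (j + m) * orthoPoly μ j).coeff (j + m) = kappa μ j := by
        rw [add_comm j m, coeff_mul_add_eq_of_natDegree_le (by rw [add_comm m j, hdj]) hdeg'.le,
          add_comm m j, hmj, one_mul, ← (orthoPoly_leadingCoeff hE hMs j).2, leadingCoeff, hdeg']
      rw [h3] at h2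
      simpa only [eval_mul] using h2
    have hsplit := hs.summable.sum_add_tsum_nat_add (j + 1)
    rw [hs.tsum_eq, Finset.sum_range_succ, Finset.sum_eq_zero (fun k hk => by
      rw [hzero k (Finset.mem_range.1 hk), mul_zero]), zero_add, hone] at hsplit
    have hκ : c ≤ kappa μ j / kappa μ (j + m) := by
      have := hratio (j + m) (by omega) (by omega)
      rwa [Nat.add_sub_cancel] at this
    have hbd : ‖a j‖ * (kappa μ j / kappa μ (j + m)) ≤ ∑' i, M * ‖a (i + (j + 1))‖ := by
      have h1 : ‖a j * ((kappa μ j : ℂ) / kappa μ (j + m))‖ =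
          ‖a j‖ * (kappa μ j / kappa μ (j + m)) := by
        rw [norm_mul, norm_div, Complex.norm_real, Complex.norm_real, Real.norm_of_nonneg
          (orthoPoly_leadingCoeff hE hMs j).1.le, Real.norm_of_nonneg
          (orthoPoly_leadingCoeff hE hMs (j + m)).1.le]
      rw [← h1, eq_neg_of_add_eq_zero_left hsplit, norm_neg]
      refine tsum_of_norm_bounded (((summable_nat_add_iff (j + 1)).2 hasum).mul_left M).hasSum
        fun i => ?_
      rw [norm_mul, mul_comm]
      exact mul_le_mul_of_nonneg_right
        (norm_fourierCoef_mul_orthoPoly_le hE hMs hMj _ _) (norm_nonneg _)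
    rw [tsum_mul_left] at hbd
    rw [div_mul_eq_mul_div, le_div_iff₀ hc]
    exact (mul_le_mul_of_nonneg_left hκ (norm_nonneg _)).trans hbd
  obtain ⟨J, hJ⟩ := exists_forall_eq_zero_of_le_tail (fun n => norm_nonneg (a n)) hdecay
    (div_nonneg hM0 hc.le) htail
  refine ⟨∑ k ∈ Finset.range J, C (a k) * orthoPoly μ k, ?_⟩
  obtain ⟨C', -, hC'⟩ := hdecay (1 / 4) (by norm_num)
  have h2 := eqOn_fourierSeries hE hμ' ENNReal.one_lt_top hH (r := 2) (by norm_num) hC'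
    (by norm_num) (by norm_num)
  filter_upwards [e, eventually_of_eqOn_canonicalDomain hE h
    (lt_min ENNReal.one_lt_top (one_lt_ofReal.2 (by norm_num))) h2] with z h3 h4
  rw [← h3, ← h4, eval_finsetSum, tsum_eq_sum (s := Finset.range J)]
  · simp only [eval_mul, eval_C]
    rfl
  · intro k hk
    have := norm_eq_zero.1 (hJ k (not_lt.1 fun h' => hk (Finset.mem_range.2 h')))
    simp only [a] at this
    rw [this, zero_mul]

end Pade

end OrthPade
end

open OrthPade in
theorem mainTheorem2 (E : Set ℂ) (hE : IsAdmissible E) (m mstar : ℕ) (hmstar : 1 ≤ mstar)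
    (hm : mstar ≤ m) (μ : Measure ℂ) (hμ : IsReg12m E m μ)
    (F : ℂ → ℂ) (hF : HolomorphicNear E F)
    (hrat : ¬ IsRationalWithAtMostPoles E F (mstar - 1))
    (Q : ℕ → ℂ[X]) (hQ : ∀ n, 1 ≤ n → IsIncompletePadeDenominator μ F n m mstar (Q n))
    (Qm : ℂ[X]) (hQm : Qm.natDegree = m)
    (hconv : limsup (fun n : ℕ => ENNReal.ofReal (coeffNorm (Q n - Qm)) ^ (1 / (n : ℝ))) atTop < 1) :
    (∃ G : ℂ → ℂ,
      IsMeromorphicExtension E F (canonicalDomain E (rhoIndex E mstar F)) G ∧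
        poleCount G (canonicalDomain E (rhoIndex E mstar F)) = mstar) ∨
      rhoIndex E mstar F < rhoIndex E 0 (fun z => Qm.eval z * F z) := by
  have hEc := hE.isCompact
  have hne : E.Nonempty := hE.infinite.nonempty
  have h := hμ.isReg12.isExteriorMap hEc
  obtain ⟨θ, hθ0, hθ1, hθ⟩ := exists_geometric_bound hconv
  have hQm0 : Qm ≠ 0 := by
    rintro rfl
    rw [natDegree_zero] at hQm
    omega
  have hR1 : 1 < rhoIndex E mstar F := one_lt_rhoIndex hEc h hF mstar
  obtain ⟨T, H, hT0, hTdeg, hH, e, hroot⟩ := exists_pole_polynomial hEc hne h hF mstar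
  rcases hTdeg.eq_or_lt with heq | hlt
  · refine Or.inl ⟨fun z => H z / T.eval z,
      isMeromorphicExtension_div hEc h hR1 hH e fun α hα => (hroot α hα).2.2, ?_⟩
    rw [poleCount_div hT0 (isOpen_canonicalDomain hEc h hR1) hH
      fun z hz => ⟨(hroot z hz).1, (hroot z hz).2.1⟩, heq]
  right
  have hdvd : T ∣ Qm := pole_polynomial_dvd hEc hne hμ.isReg12 hF hQ hQm.le hQm0 hθ0 hθ1 hθ hT0 hlt
    hH e hroot
  have hTI : T ∈ clearingIdeal E F (rhoIndex E mstar F) := ⟨H, hH, e⟩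
  have hQmI : Qm ∈ clearingIdeal E F (rhoIndex E mstar F) := Ideal.mem_of_dvd _ hdvd hTI
  by_cases htop : rhoIndex E mstar F = ⊤
  · -- `T F` is entire, hence a polynomial, against the assumption that `F` is not rational
    rw [htop] at hH
    obtain ⟨P, hP⟩ := exists_eq_polynomial_of_entire hEc hμ hF hQ
        (hmstar.trans hm) hQm hθ0 hθ1 hθ hlt
      hH e
    exact absurd ⟨P, T, hT0, by omega, hP⟩ hrat
  · -- `Q_m T F` continues to a larger domain, and the zeros of `T` can be divided out
    have hRr : ENNReal.ofReal (rhoIndex E mstar F).toReal = rhoIndex E mstar F :=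
      ENNReal.ofReal_toReal htop
    obtain ⟨r', hr', hI⟩ := exists_mul_mem_clearingIdeal hEc hμ.isReg12 hF hQ hQm.le hθ0 hθ1 hθ hlt
      (one_lt_ofReal.1 (by rwa [hRr])) (by rwa [hRr])
    have hlt' : rhoIndex E mstar F < ENNReal.ofReal r' := (ENNReal.lt_ofReal_iff_toReal_lt
        htop).2 hr'
    have hI' : Qm * (T.roots.map fun a => X - C a).prod ∈ clearingIdeal E F
        (ENNReal.ofReal r') := by
      have h1 := Ideal.mul_mem_left _ (C T.leadingCoeff⁻¹) hI
      have h2 : C T.leadingCoeff⁻¹ * (Qm * T) = Qm * (T.roots.map fun a => X - C a).prod := by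
        have h3 : T = C T.leadingCoeff * (T.roots.map fun a => X - C a).prod :=
          (IsAlgClosed.splits T).eq_prod_roots
        conv_lhs => rw [mul_left_comm]; enter [2, 2]; rw [h3]
        rw [← mul_assoc (C T.leadingCoeff⁻¹), ← C_mul,
          inv_mul_cancel₀ (leadingCoeff_ne_zero.2 hT0), C_1, one_mul]
      rwa [h2] at h1
    have hfin := mem_clearingIdeal_of_mul_prod hEc hne h hF hR1 hlt'.le hQmI T.roots
      (fun α hα => (hroot α (isRoot_of_mem_roots hα)).1) hI'
    exact hlt'.trans_le (le_rhoIndex_zero hEc h (hR1.trans hlt') hfin 0)
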